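/- Let $\pi$ be a convex polygon with $n\ge 3$ vertices. An edge on $\pi$ is a set of two vertices of $\pi$; it is an edge of $\pi$ if its convex hull is disjoint from the interior of $\pi$. Two distinct edges on $\pi$ cross if the relative interiors of their convex hulls intersect. A triangulation of $\pi$ is an inclusion-maximal set of pairwise non-crossing edges on $\pi$; its interior edges are its elements that are not edges of $\pi$. The flip-graph of $\pi$ has the triangulations of $\pi$ as vertices, and two of them are adjacent when each contains exactly one edge that the other does not contain; $d$ denotes the distance in this graph. A triangulation has an ear in a vertex $v$ if one of its triangles shares with $\pi$ its two edges incident to $v$. Let $T$ be a triangulation of $\pi$, and let $v$ be a vertex of $\pi$ incident to exactly $n-3-k$ interior edges of $T$, where $0\le k\le n-3$. A shelling of $T$ at $v$ is an ordering $a_1,\dots,a_k$ of the vertices of $\pi$ distinct from $v$ that are not joined to $v$ by an edge of $T$, such that for every $i\in\{1,\dots,k\}$ the set of the edges of $T$ incident to none of $a_i,\dots,a_k$ is a triangulation of a convex polygon. Let $\Omega(T,v)$ be the set of all triangulations $U$ of $\pi$ with an ear in $v$ such that, for some shelling $a_1,\dots,a_k$ of $T$ at $v$ and all $i\in\{1,\dots,k\}$,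 the vertex $a_i$ is incident to at least two interior edges of $U$ whose other vertex is not among $a_i,\dots,a_k$. Then every $U\in\Omega(T,v)$ satisfies $d(T,U)\ge n-3+k$. -/

import Mathlib

/-- The Euclidean plane. -/
abbrev Plane : Type := EuclideanSpace ℝ (Fin 2)

/-- `V` is the vertex set of a convex polygon: at least three points in convex position.
The polygon itself is the convex hull of `V`. -/
def IsConvexPolygon (V : Finset Plane) : Prop :=
  3 ≤ V.card ∧ ConvexIndependent ℝ (fun p : V => (p : Plane))

/-- Edges on the polygon: the two-element sets of vertices. -/
def edgesOn (V : Finset Plane) : Finset (Finset Plane) := V.powersetCard 2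

/-- The edge `e` is an edge of the polygon: its convex hull (a segment) is disjoint from the
interior of the polygon. -/
def IsBoundaryEdge (V : Finset Plane) (e : Finset Plane) : Prop :=
  e ∈ edgesOn V ∧
    Disjoint (convexHull ℝ (e : Set Plane)) (interior (convexHull ℝ (V : Set Plane)))

/-- The relative interior of an edge: the segment without its two endpoints. -/
def openEdge (e : Finset Plane) : Set Plane := convexHull ℝ (e : Set Plane) \ (e : Set Plane)

/-- Two distinct edges cross when their relative interiors meet. -/
def Crossing (e f : Finset Plane) : Prop :=
  e ≠ f ∧ (openEdge e ∩ openEdge f).Nonempty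

/-- A set of pairwise non-crossing edges on the polygon. -/
def IsNoncrossing (V : Finset Plane) (T : Finset (Finset Plane)) : Prop :=
  T ⊆ edgesOn V ∧ ∀ e ∈ T, ∀ f ∈ T, ¬ Crossing e f

/-- A triangulation of the polygon: an inclusion-maximal set of pairwise non-crossing edges. -/
def IsTriangulation (V : Finset Plane) (T : Finset (Finset Plane)) : Prop :=
  Maximal (IsNoncrossing V) T

/-- The interior edges of `T`: those that are not edges of the polygon. -/
noncomputable def interiorEdges (V : Finset Plane) (T : Finset (Finset Plane)) :
    Finset (Finset Plane) :=
  open scoped Classical in T.filter (fun e => ¬ IsBoundaryEdge V e)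

/-- The number of interior edges of `T` incident to `v`. -/
noncomputable def interiorDegree (V : Finset Plane) (T : Finset (Finset Plane)) (v : Plane) : ℕ :=
  open scoped Classical in ((interiorEdges V T).filter (fun e => v ∈ e)).card

/-- The vertices of the polygon, other than `v`, that are not joined to `v` by an edge of `T`. -/
noncomputable def nonNeighbors (V : Finset Plane) (T : Finset (Finset Plane)) (v : Plane) :
    Finset Plane :=
  open scoped Classical in V.filter (fun x => x ≠ v ∧ ({v, x} : Finset Plane) ∉ T)

/-- The flip-graph: triangulations are adjacent when each has exactly one edge that
the other does not have. -/
noncomputable def flipGraph (V : Finset Plane) :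
    SimpleGraph {T : Finset (Finset Plane) // IsTriangulation V T} where
  Adj T U := open scoped Classical in
    (T.1 \ U.1).card = 1 ∧ (U.1 \ T.1).card = 1
  symm := ⟨fun _ _ h => ⟨h.2, h.1⟩⟩
  loopless := ⟨fun T h => by simp at h⟩

/-- `T` has an ear in `v`: some triangle `v b c` of `T` shares its edges `{v, b}` and `{v, c}`
with the polygon. -/
def HasEar (V : Finset Plane) (T : Finset (Finset Plane)) (v : Plane) : Prop :=
  open scoped Classical in
  ∃ b c : Plane, b ≠ c ∧ IsBoundaryEdge V {v, b} ∧ IsBoundaryEdge V {v, c} ∧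
    ({v, b} : Finset Plane) ∈ T ∧ ({v, c} : Finset Plane) ∈ T ∧ ({b, c} : Finset Plane) ∈ T

/-- `a` is a shelling of `T` at `v`: an enumeration without repetition of the vertices
not adjacent to `v` such that, for every index `i`, the edges of `T` that are incident to none of
`a i, a (i + 1), …` form a triangulation of some convex polygon. -/
def IsShelling (V : Finset Plane) (T : Finset (Finset Plane)) (v : Plane) {k : ℕ}
    (a : Fin k → Plane) : Prop :=
  open scoped Classical in
  Function.Injective a ∧
  Set.range a = (nonNeighbors V T v : Set Plane) ∧
  ∀ i : Fin k, ∃ W : Finset Plane, IsConvexPolygon W ∧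
    IsTriangulation W (T.filter (fun e => ∀ j, i ≤ j → a j ∉ e))

/-- The set `Ω(T, v)`: triangulations `U` of the polygon with an ear in `v` such that, for some
shelling `a` of `T` at `v`, each `a i` is incident to at least two interior edges of `U` whose
other vertex is not among `a i, a (i + 1), …`. -/
def Omega (V : Finset Plane) (T : Finset (Finset Plane)) (v : Plane) :
    Set (Finset (Finset Plane)) :=
  open scoped Classical in
  {U | IsTriangulation V U ∧ HasEar V U v ∧
    ∃ (k : ℕ) (a : Fin k → Plane), IsShelling V T v a ∧
      ∀ i : Fin k, 2 ≤ ((interiorEdges V U).filter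
        (fun e => a i ∈ e ∧ ∀ x ∈ e, x ≠ a i → ∀ j, i ≤ j → x ≠ a j)).card}

/-! Only the cyclic order of the vertices matters. Edges cross when their labels interleave, so a
path of flips becomes a `FlipChain` between adjacency relations on labels. Trivial moves are allowed
in such a chain, which makes chains stable under contraction.

Contracting a vertex `a` onto a boundary neighbour `t` turns triangulations into triangulations with
one vertex fewer (`CombTri.contract`). A flip that replaces the triangle on `{a, t}` becomes trivial
and can be dropped (`contract_eq_of_third_ne`).

The bound follows by induction on `k` (`FlipChain.lower_bound`). The last vertex `a` of the shelling
is an ear of the first triangulation, with boundary neighbours `b` and `c`. In the last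
triangulation its two interior edges force the triangles on `{a, b}` and `{a, c}` to differ. The
first flip that removes `{b, c}` changes both triangles and gives them the same third vertex, so at
least one of them has to change again later. Contracting the corresponding edge therefore saves two
flips (`FlipChain.contract_ear`). This lowers `n` and `k` by one each, hence the bound by two, and
the hypotheses persist.

When `k = 0`, the vertex `v` has `n - 1` neighbours at the start and at most two at the end, and a
flip removes at most one of them. -/

/-! ### Triangulations and flips on cyclically ordered labels -/

/-- The chords `{p, q}` and `{r, s}` interleave: exactly one of `r`, `s` lies strictly between
`p` and `q`, and the other one lies strictly outside. -/
def Interleave (p q r s : ℕ) : Prop :=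
  (p < r ∧ r < q ∧ (s < p ∨ q < s)) ∨ (q < r ∧ r < p ∧ (s < q ∨ p < s)) ∨
  (p < s ∧ s < q ∧ (r < p ∨ q < r)) ∨ (q < s ∧ s < p ∧ (r < q ∨ p < r))

theorem Interleave.swap_left {p q r s : ℕ} (h : Interleave p q r s) : Interleave q p r s := by
  unfold Interleave at *; grind

theorem Interleave.swap_right {p q r s : ℕ} (h : Interleave p q r s) : Interleave p q s r := by
  unfold Interleave at *; grind

theorem Interleave.swap {p q r s : ℕ} (h : Interleave p q r s) : Interleave r s p q := by
  unfold Interleave at *; grind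

theorem Interleave.ne {p q r s : ℕ} (h : Interleave p q r s) :
    p ≠ q ∧ p ≠ r ∧ p ≠ s ∧ q ≠ r ∧ q ≠ s ∧ r ≠ s := by
  unfold Interleave at h
  rcases h with h | h | h | h <;> refine ⟨?_, ?_, ?_, ?_, ?_, ?_⟩ <;> grind

/-- A triangulation of the polygon with vertex set `S`, labelled in cyclic order, given by its
adjacency relation. -/
structure CombTri (S : Finset ℕ) (E : ℕ → ℕ → Prop) : Prop where
  symm : ∀ {p q}, E p q → E q p
  left_mem : ∀ {p q}, E p q → p ∈ S
  ne : ∀ {p q}, E p q → p ≠ q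
  noncross : ∀ {p q r s}, E p q → E r s → ¬ Interleave p q r s
  maximal : ∀ {p q}, p ∈ S → q ∈ S → p ≠ q → (∀ r s, E r s → ¬ Interleave p q r s) → E p q

theorem CombTri.right_mem {S : Finset ℕ} {E : ℕ → ℕ → Prop} (h : CombTri S E) {p q : ℕ}
    (hpq : E p q) : q ∈ S := h.left_mem (h.symm hpq)

/-- `E` has at most one edge that `F` does not have. -/
def AtMostOneLost (E F : ℕ → ℕ → Prop) : Prop :=
  ∀ {p q r s}, E p q → ¬ F p q → E r s → ¬ F r s → (p = r ∧ q = s) ∨ (p = s ∧ q = r)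

/-- A sequence of `m` moves between triangulations, each of which is a flip or trivial. -/
inductive FlipChain (S : Finset ℕ) : ℕ → (ℕ → ℕ → Prop) → (ℕ → ℕ → Prop) → Prop
  | nil {E} : CombTri S E → FlipChain S 0 E E
  | cons {m E F G} : CombTri S E → AtMostOneLost E F → AtMostOneLost F E → FlipChain S m F G →
      FlipChain S (m + 1) E G

theorem FlipChain.left {S : Finset ℕ} {m : ℕ} {E G : ℕ → ℕ → Prop} (h : FlipChain S m E G) :
    CombTri S E := by
  cases h <;> assumption

theorem FlipChain.right {S : Finset ℕ} {m : ℕ} {E G : ℕ → ℕ → Prop} (h : FlipChain S m E G) :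
    CombTri S G := by
  induction h <;> assumption

/-! ### Contraction of a boundary edge -/

/-- `a` and `t` are consecutive elements of `S`. -/
structure Consecutive (S : Finset ℕ) (a t : ℕ) : Prop where
  left_mem : a ∈ S
  right_mem : t ∈ S
  ne : a ≠ t
  out : ∀ z ∈ S, z = a ∨ z = t ∨ (z < a ∧ z < t) ∨ (a < z ∧ t < z)

theorem Consecutive.lt_iff {S : Finset ℕ} {a t : ℕ} (hat : Consecutive S a t) {z : ℕ} (hz : z ∈ S)
    (hza : z ≠ a) (hzt : z ≠ t) : (a < z ↔ t < z) ∧ (z < a ↔ z < t) := by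
  have := hat.out z hz
  grind

theorem Consecutive.interleave_iff {S : Finset ℕ} {a t : ℕ} (hat : Consecutive S a t) {q r s : ℕ}
    (hr : r ∈ S) (hs : s ∈ S) (hra : r ≠ a) (hrt : r ≠ t)
    (hsa : s ≠ a) (hst : s ≠ t) : Interleave a q r s ↔ Interleave t q r s := by
  have h2 := hat.lt_iff hr hra hrt
  have h3 := hat.lt_iff hs hsa hst
  simp only [Interleave, h2, h3]

/-- The relation obtained from `E` by contracting the vertex `a` onto the vertex `t`. -/
def contract (a t : ℕ) (E : ℕ → ℕ → Prop) (p q : ℕ) : Prop :=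
  p ≠ a ∧ q ≠ a ∧ p ≠ q ∧ (E p q ∨ (p = t ∧ E a q) ∨ (q = t ∧ E p a))

/-- No label of `S` separates `a` from `t`, so a chord avoiding both interleaves alike with chords
from either. Crossings thus lift from the contraction to `E`, and maximality descends. -/
theorem CombTri.contract {S : Finset ℕ} {E : ℕ → ℕ → Prop} (h : CombTri S E) {a t : ℕ}
    (hat : Consecutive S a t) : CombTri (S.erase a) (contract a t E) where
  symm := by
    rintro p q ⟨h1, h2, h3, h4⟩
    refine ⟨h2, h1, h3.symm, ?_⟩
    rcases h4 with h4 | h4 | h4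
    · exact Or.inl (h.symm h4)
    · exact Or.inr (Or.inr ⟨h4.1, h.symm h4.2⟩)
    · exact Or.inr (Or.inl ⟨h4.1, h.symm h4.2⟩)
  left_mem := by
    rintro p q ⟨h1, h2, h3, h4⟩
    refine Finset.mem_erase.2 ⟨h1, ?_⟩
    rcases h4 with h4 | h4 | h4
    · exact h.left_mem h4
    · exact h4.1 ▸ hat.right_mem
    · exact h.left_mem h4.2
  ne := fun h => h.2.2.1
  noncross := by
    have key : ∀ {p q}, _root_.contract a t E p q → ∃ p' q', E p' q' ∧ p ∈ S ∧ q ∈ S ∧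
        p ≠ a ∧ q ≠ a ∧ p ≠ q ∧
        ((p' = p ∧ q' = q) ∨ (p' = a ∧ p = t ∧ q' = q) ∨ (p' = p ∧ q' = a ∧ q = t)) := by
      rintro p q ⟨h1, h2, h3, h4 | ⟨rfl, h4⟩ | ⟨rfl, h4⟩⟩
      · exact ⟨p, q, h4, h.left_mem h4, h.right_mem h4, h1, h2, h3, by simp⟩
      · exact ⟨a, q, h4, hat.right_mem, h.right_mem h4, h1, h2, h3, by simp⟩
      · exact ⟨p, a, h4, h.left_mem h4, hat.right_mem, h1, h2, h3, by simp⟩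
    intro p q r s h1 h2 hX
    obtain ⟨p', q', he, hp, hq, hpa, hqa, hpq, hc⟩ := key h1
    obtain ⟨r', s', hf, hr, hs, hra, hsa, hrs, hd⟩ := key h2
    obtain ⟨npq, npr, nps, nqr, nqs, nrs⟩ := hX.ne
    refine h.noncross he hf ?_
    -- Interleaving chords share no end. When one of them is lifted from `t` to `a`, the other
    -- therefore avoids `t`, and both cannot be lifted.
    rcases hc with ⟨rfl, rfl⟩ | ⟨rfl, rfl, rfl⟩ | ⟨rfl, rfl, rfl⟩ <;>
    rcases hd with ⟨rfl, rfl⟩ | ⟨rfl, rfl, rfl⟩ | ⟨rfl, rfl, rfl⟩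
    · exact hX
    · exact ((hat.interleave_iff hp hq hpa npr hqa nqr).2 hX.swap).swap
    · exact ((hat.interleave_iff hp hq hpa nps hqa nqs).2
        hX.swap.swap_left).swap_left.swap
    · exact (hat.interleave_iff hr hs hra npr.symm hsa nps.symm).2 hX
    · exact absurd rfl npr
    · exact absurd rfl nps
    · exact ((hat.interleave_iff hr hs hra nqr.symm hsa nqs.symm).2
        hX.swap_left).swap_left
    · exact absurd rfl nqr
    · exact absurd rfl nqs
  maximal := by
    -- If neither `{t, q}` nor `{a, q}` is an edge, each is crossed by an edge of `E`. An edge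
    -- crossing the first must end at `a`, and one crossing the second must end at `t`, since
    -- otherwise it would survive the contraction and cross `{t, q}`. These two edges then cross
    -- each other.
    have key : ∀ q ∈ S, q ≠ a → q ≠ t →
        (∀ r s, _root_.contract a t E r s → ¬ Interleave t q r s) → E t q ∨ E a q := by
      intro q hq hqa hqt hX
      by_contra! hcon
      obtain ⟨h1, h2⟩ := hcon
      have h3 : ∃ r s, E r s ∧ Interleave t q r s := by
        by_contra! h3
        exact h1 (h.maximal hat.right_mem hq hqt.symm h3)
      have h4 : ∃ r s, E r s ∧ Interleave a q r s := by
        by_contra! h4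
        exact h2 (h.maximal hat.left_mem hq hqa.symm h4)
      have h3' : ∃ z, E a z ∧ Interleave t q a z := by
        obtain ⟨r, s, hrs, hI⟩ := h3
        by_cases hra : r = a
        · exact ⟨s, hra ▸ hrs, hra ▸ hI⟩
        by_cases hsa : s = a
        · refine ⟨r, h.symm (hsa ▸ hrs), ?_⟩
          subst hsa
          unfold Interleave at hI ⊢
          grind
        · exact absurd hI (hX r s ⟨hra, hsa, h.ne hrs, Or.inl hrs⟩)
      have h4' : ∃ z, E t z ∧ Interleave a q t z := by
        obtain ⟨r, s, hrs, hI⟩ := h4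
        have hr := hat.out r (h.left_mem hrs)
        have hs := hat.out s (h.right_mem hrs)
        have hq' := hat.out q hq
        by_cases hrt : r = t
        · exact ⟨s, hrt ▸ hrs, hrt ▸ hI⟩
        by_cases hst : s = t
        · refine ⟨r, h.symm (hst ▸ hrs), ?_⟩
          subst hst
          unfold Interleave at hI ⊢
          grind
        · have hra : r ≠ a := by rintro rfl; unfold Interleave at hI; grind
          have hsa : s ≠ a := by rintro rfl; unfold Interleave at hI; grind
          refine absurd ?_ (hX r s ⟨hra, hsa, h.ne hrs, Or.inl hrs⟩)
          unfold Interleave at hI ⊢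
          grind
      obtain ⟨z, hz, hIz⟩ := h3'
      obtain ⟨w, hw, hIw⟩ := h4'
      refine h.noncross hz hw ?_
      have := hat.out z (h.right_mem hz)
      have := hat.out w (h.right_mem hw)
      have := hat.out q hq
      have := hat.ne
      unfold Interleave at hIz hIw ⊢
      grind
    intro p q hp hq hpq hX
    obtain ⟨hpa, hp⟩ := Finset.mem_erase.1 hp
    obtain ⟨hqa, hq⟩ := Finset.mem_erase.1 hq
    refine ⟨hpa, hqa, hpq, ?_⟩
    by_cases hpt : p = t
    · subst hpt
      rcases key q hq hqa hpq.symm hX with h1 | h1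
      · exact Or.inl h1
      · exact Or.inr (Or.inl ⟨rfl, h1⟩)
    by_cases hqt : q = t
    · subst hqt
      rcases key p hp hpa hpq (fun r s hrs hI =>
        hX r s hrs hI.swap_left) with h1 | h1
      · exact Or.inl (h.symm h1)
      · exact Or.inr (Or.inr ⟨rfl, h.symm h1⟩)
    · refine Or.inl (h.maximal hp hq hpq fun r s hrs hI => ?_)
      have key' : ∀ s, E a s → ¬ Interleave a s p q := by
        intro s has hI
        have hs := h.right_mem has
        obtain ⟨-, -, -, nsp, nsq, -⟩ := hI.ne
        have hsa := (h.ne has).symm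
        have hst : s ≠ t := by
          rintro rfl
          have := hat.out p hp
          have := hat.out q hq
          unfold Interleave at hI
          grind
        exact hX t s ⟨hat.ne.symm, hsa, hst.symm, Or.inr (Or.inl ⟨rfl, has⟩)⟩
          ((hat.interleave_iff hp hq hpa hpt hqa hqt).1 hI).swap
      by_cases hra : r = a
      · exact key' s (hra ▸ hrs) (hra ▸ hI.swap)
      by_cases hsa : s = a
      · exact key' r (h.symm (hsa ▸ hrs)) (hsa ▸ hI.swap.swap_left)
      · exact hX r s ⟨hra, hsa, h.ne hrs, Or.inl hrs⟩ hI

/-- An edge lost by the contraction lifts to an edge lost by `E`, and the lift determines its image.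
-/
theorem AtMostOneLost.contract {E F : ℕ → ℕ → Prop} (h : AtMostOneLost E F) (a t : ℕ) :
    AtMostOneLost (contract a t E) (contract a t F) := by
  have key : ∀ {p q}, _root_.contract a t E p q → ¬ _root_.contract a t F p q →
      ∃ p' q', E p' q' ∧ ¬ F p' q' ∧ p ≠ a ∧ q ≠ a ∧ p ≠ q ∧
        ((p' = p ∧ q' = q) ∨ (p' = a ∧ p = t ∧ q' = q) ∨ (p' = p ∧ q' = a ∧ q = t)) := by
    rintro p q ⟨h1, h2, h3, h4 | ⟨rfl, h4⟩ | ⟨rfl, h4⟩⟩ hF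
    · exact ⟨p, q, h4, fun hh => hF ⟨h1, h2, h3, Or.inl hh⟩, h1, h2, h3, by simp⟩
    · exact ⟨a, q, h4, fun hh => hF ⟨h1, h2, h3, Or.inr (Or.inl ⟨rfl, hh⟩)⟩, h1, h2, h3, by simp⟩
    · exact ⟨p, a, h4, fun hh => hF ⟨h1, h2, h3, Or.inr (Or.inr ⟨rfl, hh⟩)⟩, h1, h2, h3, by simp⟩
  intro p q r s h1 h2 h3 h4
  obtain ⟨p', q', he, he', hpa, hqa, hpq, hc⟩ := key h1 h2
  obtain ⟨r', s', hf, hf', hra, hsa, hrs, hd⟩ := key h3 h4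
  have := h he he' hf hf'
  grind

theorem FlipChain.contract {S : Finset ℕ} {m : ℕ} {E G : ℕ → ℕ → Prop} (h : FlipChain S m E G)
    {a t : ℕ} (hat : Consecutive S a t) :
    FlipChain (S.erase a) m (contract a t E) (contract a t G) := by
  induction h with
  | nil hE => exact .nil (hE.contract hat)
  | cons hE h1 h2 _ ih => exact .cons (hE.contract hat) (h1.contract a t) (h2.contract a t) ih

/-! ### Flips that a contraction makes trivial -/

/-- Two edges at the two ends of a boundary edge `{a, t}` which do not meet interleave one way or
the other. -/
theorem Consecutive.interleave_or {S : Finset ℕ} {a t : ℕ} (hat : Consecutive S a t) {y z : ℕ}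
    (hy : y ∈ S) (hz : z ∈ S) (hya : y ≠ a) (hyt : y ≠ t) (hza : z ≠ a) (hzt : z ≠ t)
    (hyz : y ≠ z) : Interleave a y t z ∨ Interleave a z t y := by
  have h1 := hat.out y hy
  have h2 := hat.out z hz
  have := hat.ne
  simp only [hya, hyt, hza, hzt, false_or] at h1 h2
  unfold Interleave
  rcases h1 with h1 | h1 <;> rcases h2 with h2 | h2 <;> rcases lt_or_gt_of_ne this with h3 | h3 <;>
  rcases lt_or_gt_of_ne hyz with h4 | h4 <;> simp only [h1, h2, h3, h4, true_and, not_lt_of_gt, true_or, or_true]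

/-- A flip that changes the triangle on `{a, t}` becomes trivial when `a` is contracted
onto `t`. -/
theorem contract_eq_of_third_ne {S : Finset ℕ} {E F : ℕ → ℕ → Prop} (hE : CombTri S E)
    (hF : CombTri S F) (h1 : AtMostOneLost E F) (h2 : AtMostOneLost F E) {a t : ℕ}
    (hat : Consecutive S a t) {y z : ℕ} (hay : E a y) (hty : E t y) (haz : F a z) (htz : F t z)
    (hyz : y ≠ z) : contract a t E = contract a t F := by
  wlog hX : Interleave a y t z generalizing E F y z
  · have hor := hat.interleave_or (hE.right_mem hay) (hF.right_mem haz) (hE.ne hay).symm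
      (hE.ne hty).symm (hF.ne haz).symm (hF.ne htz).symm hyz
    exact (this hF hE h2 h1 haz htz hay hty hyz.symm (hor.resolve_left hX)).symm
  -- The flip exchanges the diagonals `{a, y}` and `{t, z}` of a quadrilateral. Its sides `{t, y}`
  -- and `{a, z}` lie in both triangulations and already contract to the images of these diagonals.
  have hF' : ¬ F a y := fun h => hF.noncross h htz hX
  have hE' : ¬ E t z := fun h => hE.noncross hay h hX
  have hne := hat.ne
  have e1 : ∀ p q, E p q → F p q ∨ (a = p ∧ y = q) ∨ (a = q ∧ y = p) := fun p q h =>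
    or_iff_not_imp_left.2 fun h' => h1 hay hF' h h'
  have e2 : ∀ p q, F p q → E p q ∨ (t = p ∧ z = q) ∨ (t = q ∧ z = p) := fun p q h =>
    or_iff_not_imp_left.2 fun h' => h2 htz hE' h h'
  have hFty : F t y := by
    rcases e1 t y hty with h | h | h
    · exact h
    · exact absurd h.1 hne
    · exact absurd h.2 (hE.ne hty).symm
  have hEaz : E a z := by
    rcases e2 a z haz with h | h | h
    · exact h
    · exact absurd h.1.symm hne
    · exact absurd h.2 (hF.ne haz).symm
  funext p q
  apply propext
  constructor
  · rintro ⟨hp, hq, hpq, h | ⟨rfl, h⟩ | ⟨rfl, h⟩⟩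
    · rcases e1 p q h with h | h | h
      · exact ⟨hp, hq, hpq, Or.inl h⟩
      · exact absurd h.1.symm hp
      · exact absurd h.1.symm hq
    · rcases e1 a q h with h | ⟨_, rfl⟩ | ⟨rfl, _⟩
      · exact ⟨hp, hq, hpq, Or.inr (Or.inl ⟨rfl, h⟩)⟩
      · exact ⟨hp, hq, hpq, Or.inl hFty⟩
      · exact absurd rfl hq
    · rcases e1 p a h with h | ⟨rfl, _⟩ | ⟨_, rfl⟩
      · exact ⟨hp, hq, hpq, Or.inr (Or.inr ⟨rfl, h⟩)⟩
      · exact absurd rfl hp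
      · exact ⟨hp, hq, hpq, Or.inl (hF.symm hFty)⟩
  · rintro ⟨hp, hq, hpq, h | ⟨rfl, h⟩ | ⟨rfl, h⟩⟩
    · rcases e2 p q h with h | ⟨rfl, rfl⟩ | ⟨rfl, rfl⟩
      · exact ⟨hp, hq, hpq, Or.inl h⟩
      · exact ⟨hp, hq, hpq, Or.inr (Or.inl ⟨rfl, hEaz⟩)⟩
      · exact ⟨hp, hq, hpq, Or.inr (Or.inr ⟨rfl, hE.symm hEaz⟩)⟩
    · rcases e2 a q h with h | h | h
      · exact ⟨hp, hq, hpq, Or.inr (Or.inl ⟨rfl, h⟩)⟩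
      · exact absurd h.1.symm hne
      · exact absurd h.1 hpq
    · rcases e2 p a h with h | h | h
      · exact ⟨hp, hq, hpq, Or.inr (Or.inr ⟨rfl, h⟩)⟩
      · exact absurd h.1.symm hpq
      · exact absurd h.1.symm hne

/-- A boundary edge belongs to a triangle. -/
theorem CombTri.exists_third {S : Finset ℕ} {E : ℕ → ℕ → Prop} (h : CombTri S E) {a t : ℕ}
    (hat : Consecutive S a t) (hex : ∃ y, E a y ∧ y ≠ t) : ∃ y, E a y ∧ E t y := by
  classical
  -- The neighbour of `a` closest to `t` along the boundary is taken: the counted vertices are those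
  -- that `{t, y}` separates from `a`. An edge crossing `{t, y}` would come from `a`, against
  -- minimality, or cross `{a, y}`.
  obtain ⟨y, hy, hmin⟩ := Finset.exists_min_image (S.filter fun y => E a y ∧ y ≠ t)
    (fun y => (S.filter fun z => Interleave a z t y).card)
    (by obtain ⟨y, hy, hyt⟩ := hex
        exact ⟨y, Finset.mem_filter.2 ⟨h.right_mem hy, hy, hyt⟩⟩)
  obtain ⟨hyS, hay, hyt⟩ := Finset.mem_filter.1 hy
  have hya := (h.ne hay).symm
  have hne := hat.ne
  have hy' := hat.out y hyS
  have hmin' : ∀ w, E a w → ¬ Interleave a w t y := by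
    intro w hw hI
    have hwS := h.right_mem hw
    have hw' := hat.out w hwS
    have hwt : w ≠ t := by rintro rfl; unfold Interleave at hI; grind
    have := hmin w (Finset.mem_filter.2 ⟨hwS, hw, hwt⟩)
    refine absurd this (not_le.2 (Finset.card_lt_card ?_))
    rw [Finset.ssubset_iff_of_subset]
    · refine ⟨w, Finset.mem_filter.2 ⟨hwS, hI⟩, fun hh => ?_⟩
      have := (Finset.mem_filter.1 hh).2
      unfold Interleave at this
      grind
    · intro z hz
      obtain ⟨hzS, hz⟩ := Finset.mem_filter.1 hz
      refine Finset.mem_filter.2 ⟨hzS, ?_⟩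
      have hz' := hat.out z hzS
      have hwa := h.ne hw
      unfold Interleave at hz hI ⊢
      grind
  refine ⟨y, hay, h.maximal hat.right_mem hyS hyt.symm fun r s hrs hI => ?_⟩
  have hr := hat.out r (h.left_mem hrs)
  have hs := hat.out s (h.right_mem hrs)
  by_cases hra : r = a
  · subst hra
    refine hmin' s hrs ?_
    unfold Interleave at hI ⊢
    grind
  by_cases hsa : s = a
  · subst hsa
    refine hmin' r (h.symm hrs) ?_
    unfold Interleave at hI ⊢
    grind
  refine h.noncross hay hrs ?_
  unfold Interleave at hI ⊢
  grind

theorem Consecutive.not_interleave {S : Finset ℕ} {a t : ℕ} (hat : Consecutive S a t) {r s : ℕ}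
    (hr : r ∈ S) (hs : s ∈ S) : ¬ Interleave a t r s := by
  have := hat.out r hr
  have := hat.out s hs
  unfold Interleave
  grind

theorem CombTri.consecutive {S : Finset ℕ} {E : ℕ → ℕ → Prop} (h : CombTri S E) {a t : ℕ}
    (hat : Consecutive S a t) : E a t :=
  h.maximal hat.left_mem hat.right_mem hat.ne fun _ _ hrs =>
    hat.not_interleave (h.left_mem hrs) (h.right_mem hrs)

/-- If the triangle on `{a, t}` changes along a sequence of flips, then one of them is lost in the
contraction. -/
theorem FlipChain.contract_of_third_ne {S : Finset ℕ} {m : ℕ} {E G : ℕ → ℕ → Prop}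
    (h : FlipChain S m E G) {a t u : ℕ} (hat : Consecutive S a t) (hau : Consecutive S a u)
    (htu : u ≠ t) {y z : ℕ} (hay : E a y) (hty : E t y) (haz : G a z) (htz : G t z) (hyz : y ≠ z) :
    ∃ m', m = m' + 1 ∧ FlipChain (S.erase a) m' (_root_.contract a t E)
      (_root_.contract a t G) := by
  induction h generalizing y with
  | nil hE =>
    rcases hat.interleave_or (hE.right_mem hay) (hE.right_mem haz) (hE.ne hay).symm
      (hE.ne hty).symm (hE.ne haz).symm (hE.ne htz).symm hyz with hX | hX
    · exact absurd hX (hE.noncross hay htz)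
    · exact absurd hX (hE.noncross haz hty)
  | @cons m E F G hE h1 h2 hc ih =>
    obtain ⟨x, hax, htx⟩ := hc.left.exists_third hat ⟨u, hc.left.consecutive hau, htu⟩
    by_cases hyx : y = x
    · subst hyx
      obtain ⟨m', rfl, hm'⟩ := ih hax htx haz htz hyz
      exact ⟨m' + 1, rfl, .cons (hE.contract hat) (h1.contract a t) (h2.contract a t) hm'⟩
    · refine ⟨m, rfl, ?_⟩
      rw [contract_eq_of_third_ne hE hc.left h1 h2 hat hay hty hax htx hyx]
      exact hc.contract hat

/-- If `a` is an ear of the first triangulation and its two boundary edges lie in different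
triangles of the last one, then contracting one of these edges loses two flips. -/
theorem FlipChain.contract_ear {S : Finset ℕ} {m : ℕ} {E G : ℕ → ℕ → Prop}
    (h : FlipChain S m E G) {a b c : ℕ} (hab : Consecutive S a b) (hac : Consecutive S a c)
    (hbc : b ≠ c) (hE : E b c) (hG : ¬ G b c) {y z : ℕ} (hay : G a y) (hby : G b y) (haz : G a z)
    (hcz : G c z) (hyz : y ≠ z) :
    ∃ m', m = m' + 2 ∧
      (FlipChain (S.erase a) m' (_root_.contract a b E) (_root_.contract a b G) ∨
        FlipChain (S.erase a) m' (_root_.contract a c E) (_root_.contract a c G)) := by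
  induction h with
  | nil => exact absurd hE hG
  | @cons m E F G hT h1 h2 hc ih =>
    by_cases hF : F b c
    · obtain ⟨m', rfl, hm'⟩ := ih hF hG hay hby haz hcz
      refine ⟨m' + 1, rfl, hm'.imp (fun hm' => ?_) fun hm' => ?_⟩
      · exact .cons (hT.contract hab) (h1.contract a b) (h2.contract a b) hm'
      · exact .cons (hT.contract hac) (h1.contract a c) (h2.contract a c) hm'
    -- This move destroys the ear at `a`.
    · have hFT := hc.left
      obtain ⟨x, hax, hbx⟩ := hFT.exists_third hab ⟨c, hFT.consecutive hac, hbc.symm⟩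
      obtain ⟨w, haw, hcw⟩ := hFT.exists_third hac ⟨b, hFT.consecutive hab, hbc⟩
      have hxc : x ≠ c := by rintro rfl; exact hF hbx
      have hwb : w ≠ b := by rintro rfl; exact hF (hFT.symm hcw)
      have hEab := hT.consecutive hab
      have hEac := hT.consecutive hac
      have hnew : ∀ x, F a x → x ≠ b → x ≠ c → ¬ E a x := by
        intro x hax hxb hxc hx
        refine hT.noncross hx hE ?_
        have := hab.out x (hFT.right_mem hax)
        have := hac.out x (hFT.right_mem hax)
        have := hab.out c hac.right_mem
        have := hac.out b hab.right_mem
        have := hFT.ne hax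
        have := hab.ne
        have := hac.ne
        unfold Interleave
        grind
      -- Both `{a, x}` and `{a, w}` are new, and the move creates at most one edge.
      have hxw : x = w := by
        have := h2 hax (hnew x hax (hFT.ne hbx).symm hxc) haw (hnew w haw hwb (hFT.ne hcw).symm)
        have := hFT.ne hax
        grind
      subst hxw
      have eb := contract_eq_of_third_ne hT hFT h1 h2 hab hEac hE hax hbx hxc.symm
      have ec := contract_eq_of_third_ne hT hFT h1 h2 hac hEab (hT.symm hE) hax hcw hwb.symm
      rw [eb, ec]
      -- As `y ≠ z`, the vertex `x` differs from one of them, and the triangle on that side must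
      -- change once more.
      by_cases hxy : x = y
      · obtain ⟨m', rfl, hm'⟩ := hc.contract_of_third_ne hac hab hbc hax hcw haz hcz
          (by rintro rfl; exact hyz hxy.symm)
        exact ⟨m', rfl, Or.inr hm'⟩
      · obtain ⟨m', rfl, hm'⟩ := hc.contract_of_third_ne hab hac hbc.symm hax hbx hay hby hxy
        exact ⟨m', rfl, Or.inl hm'⟩

/-! ### The induction along the shelling -/

open scoped Classical in
theorem FlipChain.card_neighbors_le {S : Finset ℕ} {m : ℕ} {E G : ℕ → ℕ → Prop}
    (h : FlipChain S m E G) (v : ℕ) :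
    (S.filter (E v)).card ≤ (S.filter (G v)).card + m := by
  induction h with
  | nil => exact le_rfl
  | @cons m E F G hT h1 h2 hc ih =>
    have h3 : (S.filter (E v) \ S.filter (F v)).card ≤ 1 := by
      refine Finset.card_le_one.2 fun x hx y hy => ?_
      simp only [Finset.mem_sdiff, Finset.mem_filter, not_and] at hx hy
      have := h1 hx.1.2 (hx.2 hx.1.1) hy.1.2 (hy.2 hy.1.1)
      grind
    have := Finset.card_le_card_sdiff_add_card (s := S.filter (E v)) (t := S.filter (F v))
    omega

/-- The lower bound on the number of flips. The vertices `a i` with `i < k` are those not joined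
to `v`, in the order of a shelling of `E`. -/
theorem FlipChain.lower_bound {v : ℕ} (k : ℕ) :
    ∀ {S : Finset ℕ} {m : ℕ} {E F : ℕ → ℕ → Prop}, FlipChain S m E F → ∀ a : ℕ → ℕ,
    v ∈ S → 3 ≤ S.card → (∀ x ∈ S, v ≤ x) →
    (∀ i < k, a i ∈ S ∧ a i ≠ v ∧ ¬ E v (a i)) →
    (∀ i < k, ∀ j < k, a i = a j → i = j) →
    (∀ x ∈ S, x ≠ v → E v x ∨ ∃ i < k, a i = x) →
    (∀ i < k, ∀ b ∈ S, ∀ c ∈ S, b ≠ c → (∀ j, i ≤ j → j < k → b ≠ a j ∧ c ≠ a j) →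
      (∀ r ∈ S, ∀ s ∈ S, (∀ j, i ≤ j → j < k → r ≠ a j ∧ s ≠ a j) → ¬ Interleave b c r s) →
      E b c) →
    (∀ i < k, ∃ p q, p ≠ q ∧ ∀ x, x = p ∨ x = q → F (a i) x ∧
      (∀ j, i ≤ j → j < k → x ≠ a j) ∧ ∃ r ∈ S, ∃ s ∈ S, Interleave (a i) x r s) →
    (∀ x, F v x → ∀ r ∈ S, ∀ s ∈ S, ¬ Interleave v x r s) →
    S.card - 3 + k ≤ m := by
  classical
  induction k with
  | zero =>
    intro S m E F h a hv hS hmin _ _ hall _ _ hear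
    have h1 := h.card_neighbors_le v
    have hE : S.erase v ⊆ S.filter (E v) := by
      intro x hx
      obtain ⟨hxv, hx⟩ := Finset.mem_erase.1 hx
      rcases hall x hx hxv with h | ⟨i, hi, _⟩
      · exact Finset.mem_filter.2 ⟨hx, h⟩
      · omega
    have h2 := Finset.card_le_card hE
    rw [Finset.card_erase_of_mem hv] at h2
    have hne : (S.erase v).Nonempty := by
      rw [← Finset.card_pos, Finset.card_erase_of_mem hv]; omega
    -- Since `v` has the least label, its boundary neighbours carry the smallest and the largest of
    -- the other labels.
    have hF : S.filter (F v) ⊆ {(S.erase v).min' hne, (S.erase v).max' hne} := by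
      intro x hx
      obtain ⟨hx, hFx⟩ := Finset.mem_filter.1 hx
      have hxv := (h.right.ne hFx).symm
      have hxe := Finset.mem_erase.2 ⟨hxv, hx⟩
      by_contra hcon
      simp only [Finset.mem_insert, Finset.mem_singleton, not_or] at hcon
      have e1 := Finset.min'_le _ _ hxe
      have e2 := Finset.le_max' _ _ hxe
      have m1 := Finset.mem_of_mem_erase ((S.erase v).min'_mem hne)
      have m2 := Finset.mem_of_mem_erase ((S.erase v).max'_mem hne)
      have n1 := Finset.ne_of_mem_erase ((S.erase v).min'_mem hne)
      have := hmin _ m1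
      refine hear x hFx _ m1 _ m2 ?_
      unfold Interleave
      grind
    have h3 := (Finset.card_le_card hF).trans Finset.card_le_two
    omega
  | succ k ih =>
    intro S m E F h a hv hS hmin ha hinj hall hshell hint hear
    have hET := h.left
    have hFT := h.right
    obtain ⟨haS, hav, haE⟩ := ha k (by omega)
    have hlt : v < a k := lt_of_le_of_ne (hmin _ haS) hav.symm
    have hne1 : (S.filter (· < a k)).Nonempty := ⟨v, Finset.mem_filter.2 ⟨hv, hlt⟩⟩
    -- If `a k` had the largest label, it would be a boundary neighbour of `v`, hence joined to `v`
    -- in `E`.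
    have hne2 : (S.filter (a k < ·)).Nonempty := by
      by_contra hcon
      rw [Finset.not_nonempty_iff_eq_empty, Finset.filter_eq_empty_iff] at hcon
      refine haE (hET.maximal hv haS hav.symm fun r s hrs => ?_)
      have := hcon (hET.left_mem hrs)
      have := hcon (hET.right_mem hrs)
      have := hmin r (hET.left_mem hrs)
      have := hmin s (hET.right_mem hrs)
      unfold Interleave
      grind
    obtain ⟨b, hbS, hba, hbmax⟩ : ∃ b ∈ S, b < a k ∧ ∀ z ∈ S, z < a k → z ≤ b := by
      have := Finset.mem_filter.1 (Finset.max'_mem _ hne1)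
      exact ⟨_, this.1, this.2, fun z hz hza => Finset.le_max' _ _ (Finset.mem_filter.2 ⟨hz, hza⟩)⟩
    obtain ⟨c, hcS, hac, hcmin⟩ : ∃ c ∈ S, a k < c ∧ ∀ z ∈ S, a k < z → c ≤ z := by
      have := Finset.mem_filter.1 (Finset.min'_mem _ hne2)
      exact ⟨_, this.1, this.2, fun z hz hza => Finset.min'_le _ _ (Finset.mem_filter.2 ⟨hz, hza⟩)⟩
    have Cb : Consecutive S (a k) b := ⟨haS, hbS, hba.ne', fun z hz => by
      have := hbmax z hz
      omega⟩
    have Cc : Consecutive S (a k) c := ⟨haS, hcS, hac.ne, fun z hz => by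
      have := hcmin z hz
      omega⟩
    have hbc : b ≠ c := (hba.trans hac).ne
    -- Without `a k`, the vertices `b` and `c` are consecutive, so the shelling provides this edge.
    have hEbc : E b c := by
      refine hshell k (by omega) b hbS c hcS hbc (fun j h1 h2 => ?_) fun r hr s hs hne => ?_
      · obtain rfl : j = k := by omega
        exact ⟨hba.ne, hac.ne'⟩
      · have := hne k le_rfl (by omega)
        have := Cb.out r hr
        have := Cb.out s hs
        have := Cc.out r hr
        have := Cc.out s hs
        unfold Interleave
        grind
    obtain ⟨p, q, hpq, hx⟩ := hint k (by omega)
    have hmid : ∀ x, x = p ∨ x = q → F (a k) x ∧ x ≠ b ∧ x ≠ c := by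
      intro x hx'
      obtain ⟨h1, -, r, hr, s, hs, hI⟩ := hx x hx'
      exact ⟨h1, by rintro rfl; exact Cb.not_interleave hr hs hI,
        by rintro rfl; exact Cc.not_interleave hr hs hI⟩
    have hsep : ∀ x, x = p ∨ x = q → x ∈ S ∧ x ≠ a k ∧ (x < b ∨ c < x) := by
      intro x hx'
      obtain ⟨h1, h2, h3⟩ := hmid x hx'
      have hxS := hFT.right_mem h1
      have := hFT.ne h1
      have := Cb.out x hxS
      have := Cc.out x hxS
      exact ⟨hxS, by omega, by omega⟩
    have hFbc : ¬ F b c := by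
      intro hF
      refine hFT.noncross hF (hmid p (Or.inl rfl)).1 ?_
      have := hsep p (Or.inl rfl)
      unfold Interleave
      grind
    obtain ⟨y, hay, hby⟩ := hFT.exists_third Cb ⟨c, hFT.consecutive Cc, hbc.symm⟩
    obtain ⟨z, haz, hcz⟩ := hFT.exists_third Cc ⟨b, hFT.consecutive Cb, hbc⟩
    -- With a common third vertex `y`, the edges `{b, y}` and `{c, y}` would block every edge from
    -- `a k` to a vertex other than `b`, `c` and `y`, leaving room for one interior edge only.
    have hyz : y ≠ z := by
      rintro rfl
      have key : ∀ x, x = p ∨ x = q → x = y := by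
        intro x hx'
        by_contra hxy
        obtain ⟨h1, h2, h3⟩ := hmid x hx'
        have e1 := hFT.noncross h1 hby
        have e2 := hFT.noncross h1 hcz
        have := hsep x hx'
        have := hFT.ne hay
        have := hFT.ne hby
        have := hFT.ne hcz
        have := Cb.out y (hFT.right_mem hay)
        have := Cc.out y (hFT.right_mem hay)
        unfold Interleave at e1 e2
        grind
      exact hpq ((key p (Or.inl rfl)).trans (key q (Or.inr rfl)).symm)
    -- Edges away from `a k` survive either contraction, which carries the hypotheses over to the
    -- remaining `k` vertices. The side to contract is chosen only at the end.
    have hstep : ∀ t, Consecutive S (a k) t → ∀ m', FlipChain (S.erase (a k)) m'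
        (_root_.contract (a k) t E) (_root_.contract (a k) t F) → S.card - 3 + k ≤ m' + 1 := by
      intro t hat m' hm'
      have hvt : v ≠ t := by
        rintro rfl
        exact haE (hET.symm (hET.consecutive hat))
      have hcard := Finset.card_erase_of_mem haS
      have hle : ∀ i < k, a i ≠ a k := fun i hi he => by
        have := hinj i (by omega) k (by omega) he
        omega
      have hsub : ∀ {p q}, p ≠ a k → q ≠ a k → E p q → _root_.contract (a k) t E p q :=
        fun h1 h2 h => ⟨h1, h2, hET.ne h, Or.inl h⟩
      have hsubF : ∀ {p q}, p ≠ a k → q ≠ a k → F p q → _root_.contract (a k) t F p q :=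
        fun h1 h2 h => ⟨h1, h2, hFT.ne h, Or.inl h⟩
      have h4 : 3 ≤ (S.erase (a k)).card := by
        have hvb : v ≠ b := by rintro rfl; exact haE (hET.symm (hET.consecutive Cb))
        have hvc : v ≠ c := by rintro rfl; exact haE (hET.symm (hET.consecutive Cc))
        have hsub3 : ({v, b, c} : Finset ℕ) ⊆ S.erase (a k) := by
          intro x hx
          simp only [Finset.mem_insert, Finset.mem_singleton] at hx
          rcases hx with rfl | rfl | rfl
          · exact Finset.mem_erase.2 ⟨hlt.ne, hv⟩
          · exact Finset.mem_erase.2 ⟨hba.ne, hbS⟩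
          · exact Finset.mem_erase.2 ⟨hac.ne', hcS⟩
        have := Finset.card_le_card hsub3
        rwa [Finset.card_eq_three.2 ⟨v, b, c, hvb, hvc, hbc, rfl⟩] at this
      have := ih hm' a (Finset.mem_erase.2 ⟨hlt.ne, hv⟩) h4
        (fun x hx => hmin x (Finset.mem_of_mem_erase hx)) ?_ ?_ ?_ ?_ ?_ ?_
      · omega
      · intro i hi
        obtain ⟨h1, h2, h3⟩ := ha i (by omega)
        refine ⟨Finset.mem_erase.2 ⟨hle i hi, h1⟩, h2, ?_⟩
        rintro ⟨-, -, -, h | ⟨h, -⟩ | ⟨-, h⟩⟩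
        · exact h3 h
        · exact hvt h
        · exact haE h
      · intro i hi j hj
        exact hinj i (by omega) j (by omega)
      · intro x hx hxv
        obtain ⟨hxa, hx⟩ := Finset.mem_erase.1 hx
        rcases hall x hx hxv with h | ⟨i, hi, rfl⟩
        · exact Or.inl (hsub hlt.ne hxa h)
        · refine Or.inr ⟨i, lt_of_le_of_ne (by omega) ?_, rfl⟩
          rintro rfl
          exact hxa rfl
      · intro i hi b hb c hc hbc hne hcr
        obtain ⟨hba, hb⟩ := Finset.mem_erase.1 hb
        obtain ⟨hca, hc⟩ := Finset.mem_erase.1 hc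
        refine hsub hba hca (hshell i (by omega) b hb c hc hbc (fun j h1 h2 => ?_)
          fun r hr s hs hrs => ?_)
        · rcases Nat.lt_succ_iff_lt_or_eq.1 h2 with h2 | rfl
          · exact hne j h1 h2
          · exact ⟨hba, hca⟩
        · have := hrs k (by omega) (by omega)
          exact hcr r (Finset.mem_erase.2 ⟨this.1, hr⟩) s (Finset.mem_erase.2 ⟨this.2, hs⟩)
            fun j h1 h2 => hrs j h1 (by omega)
      · intro i hi
        obtain ⟨p', q', hpq', hx'⟩ := hint i (by omega)
        refine ⟨p', q', hpq', fun x hxpq => ?_⟩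
        obtain ⟨h1, h2, r, hr, s, hs, hI⟩ := hx' x hxpq
        have hxa := h2 k (by omega) (by omega)
        refine ⟨hsubF (hle i hi) hxa h1, fun j h3 h4 => h2 j h3 (by omega), ?_⟩
        have hiS := (ha i (by omega)).1
        have hxS := hFT.right_mem h1
        have hia := hle i hi
        -- The only chord turned into a boundary edge by removing `a k` is `{b, c}`, which is not in
        -- `F`. Hence a crossing witness `a k` can be replaced by whichever of `b` and `c` is not an
        -- end of the chord.
        have hne' : ¬ (a i = b ∧ x = c) ∧ ¬ (a i = c ∧ x = b) :=
          ⟨fun hh => hFbc (hh.1 ▸ hh.2 ▸ h1), fun hh => hFbc (hFT.symm (hh.1 ▸ hh.2 ▸ h1))⟩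
        have o1 := Cb.out _ hiS
        have o2 := Cc.out _ hiS
        have o3 := Cb.out _ hxS
        have o4 := Cc.out _ hxS
        have key : ∀ s ∈ S, s ≠ a k → Interleave (a i) x (a k) s →
            ∃ r ∈ S.erase (a k), ∃ s ∈ S.erase (a k), Interleave (a i) x r s := by
          intro s hs hsa hI
          have hs' := Finset.mem_erase.2 ⟨hsa, hs⟩
          have hb' := Finset.mem_erase.2 ⟨hba.ne, hbS⟩
          have hc' := Finset.mem_erase.2 ⟨hac.ne', hcS⟩
          by_cases hb1 : a i ≠ b ∧ x ≠ b
          · refine ⟨b, hb', s, hs', ?_⟩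
            unfold Interleave at hI ⊢
            grind
          · refine ⟨c, hc', s, hs', ?_⟩
            unfold Interleave at hI ⊢
            grind
        by_cases hra : r = a k
        · subst hra
          exact key s hs hI.ne.2.2.2.2.2.symm hI
        by_cases hsa : s = a k
        · subst hsa
          exact key r hr hra hI.swap_right
        exact ⟨r, Finset.mem_erase.2 ⟨hra, hr⟩, s, Finset.mem_erase.2 ⟨hsa, hs⟩, hI⟩
      · intro x hvx r hr s hs
        refine hear x ?_ r (Finset.mem_of_mem_erase hr) s (Finset.mem_of_mem_erase hs)
        obtain ⟨-, -, -, h | ⟨h, -⟩ | ⟨-, h⟩⟩ := hvx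
        · exact h
        · exact absurd h hvt
        -- An edge of `F` from `v` to `a k` would be a boundary edge and so belong to `E`.
        · refine absurd ?_ haE
          exact hET.maximal hv haS hav.symm fun r s hrs =>
            hear _ h r (hET.left_mem hrs) s (hET.right_mem hrs)
    obtain ⟨m', rfl, hm' | hm'⟩ := h.contract_ear Cb Cc hbc hEbc hFbc hay hby haz hcz hyz
    · have := hstep b Cb m' hm'
      omega
    · have := hstep c Cc m' hm'
      omega

/-! ### Orientation and convex position -/

/-- Twice the signed area of the triangle `p q r`. -/
def orient (p q r : Plane) : ℝ := (q 0 - p 0) * (r 1 - p 1) - (q 1 - p 1) * (r 0 - p 0)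

theorem orient_rotate (p q r : Plane) : orient q r p = orient p q r := by
  unfold orient; ring

theorem orient_swap (p q r : Plane) : orient q p r = - orient p q r := by
  unfold orient; ring

theorem orient_self_left (p q : Plane) : orient p q p = 0 := by
  unfold orient; ring

theorem orient_self_right (p q : Plane) : orient p q q = 0 := by
  unfold orient; ring

theorem orient_combo (p q r s : Plane) {a b : ℝ} (hab : a + b = 1) :
    orient p q (a • r + b • s) = a * orient p q r + b * orient p q s := by
  obtain rfl : b = 1 - a := by linarith
  simp only [orient, PiLp.add_apply, PiLp.smul_apply, smul_eq_mul]
  ring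

theorem plane_ext {x y : Plane} (h0 : x 0 = y 0) (h1 : x 1 = y 1) : x = y := by
  ext i
  fin_cases i
  · exact h0
  · exact h1

theorem continuous_orient (p q : Plane) : Continuous (orient p q) := by
  unfold orient
  fun_prop

/-- The weights are not normalized, so that signed areas can serve as weights. -/
theorem Convex.combo_three {K : Set Plane} (hK : Convex ℝ K) {x y z : Plane} (hx : x ∈ K)
    (hy : y ∈ K) (hz : z ∈ K) {a b c : ℝ} (ha : 0 ≤ a) (hb : 0 ≤ b) (hc : 0 ≤ c)
    (habc : 0 < a + b + c) {w : Plane}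
    (h0 : a * x 0 + b * y 0 + c * z 0 = (a + b + c) * w 0)
    (h1 : a * x 1 + b * y 1 + c * z 1 = (a + b + c) * w 1) : w ∈ K := by
  have h := hK.sum_mem (t := Finset.univ)
    (w := ![a / (a + b + c), b / (a + b + c), c / (a + b + c)]) (z := ![x, y, z]) ?_ ?_ ?_
  · convert h using 1
    rw [Fin.sum_univ_three]
    apply plane_ext
    · simp only [Matrix.cons_val, PiLp.add_apply, PiLp.smul_apply, smul_eq_mul]
      rw [div_mul_eq_mul_div, div_mul_eq_mul_div, div_mul_eq_mul_div, ← add_div, ← add_div, h0]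
      field_simp
    · simp only [Matrix.cons_val, PiLp.add_apply, PiLp.smul_apply, smul_eq_mul]
      rw [div_mul_eq_mul_div, div_mul_eq_mul_div, div_mul_eq_mul_div, ← add_div, ← add_div, h1]
      field_simp
  · intro i _
    fin_cases i <;> simp <;> positivity
  · rw [Fin.sum_univ_three]
    simp only [Matrix.cons_val]
    rw [← add_div, ← add_div, div_self habc.ne']
  · intro i _
    fin_cases i <;> simpa

theorem IsConvexPolygon.notMem_convexHull {V : Finset Plane} (hV : IsConvexPolygon V) {x : Plane}
    (hx : x ∈ V) : x ∉ convexHull ℝ ((V : Set Plane) \ {x}) :=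
  convexIndependent_set_iff_notMem_convexHull_sdiff.1 hV.2 x hx

theorem IsConvexPolygon.no_combo {V : Finset Plane} (hV : IsConvexPolygon V) {w x y z : Plane}
    (hw : w ∈ V) (hx : x ∈ V) (hy : y ∈ V) (hz : z ∈ V) (hxw : x ≠ w) (hyw : y ≠ w) (hzw : z ≠ w)
    {a b c : ℝ} (ha : 0 ≤ a) (hb : 0 ≤ b) (hc : 0 ≤ c) (habc : 0 < a + b + c)
    (h0 : a * x 0 + b * y 0 + c * z 0 = (a + b + c) * w 0)
    (h1 : a * x 1 + b * y 1 + c * z 1 = (a + b + c) * w 1) : False := by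
  have hmem : ∀ u ∈ V, u ≠ w → u ∈ convexHull ℝ ((V : Set Plane) \ {w}) :=
    fun u hu huw => subset_convexHull ℝ _ ⟨hu, huw⟩
  exact hV.notMem_convexHull hw ((convex_convexHull ℝ _).combo_three
    (hmem x hx hxw) (hmem y hy hyw) (hmem z hz hzw) ha hb hc habc h0 h1)

theorem IsConvexPolygon.not_wbtw {V : Finset Plane} (hV : IsConvexPolygon V) {x y z : Plane}
    (hx : x ∈ V) (hy : y ∈ V) (hz : z ∈ V) (hxy : x ≠ y) (hzy : z ≠ y) : ¬ Wbtw ℝ x y z := by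
  intro h
  rw [← mem_segment_iff_wbtw] at h
  exact hV.notMem_convexHull hy (segment_subset_convexHull (s := (V : Set Plane) \ {y})
    ⟨hx, hxy⟩ ⟨hz, hzy⟩ h)

theorem collinear_of_orient_eq_zero {p q r : Plane} (hpq : p ≠ q) (h : orient p q r = 0) :
    Collinear ℝ ({p, q, r} : Set Plane) := by
  rw [collinear_iff_of_mem (p₀ := p) (by simp)]
  refine ⟨q - p, ?_⟩
  have hr : ∃ t : ℝ, r = t • (q - p) +ᵥ p := by
    have h' : q 0 - p 0 ≠ 0 ∨ q 1 - p 1 ≠ 0 := by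
      by_contra! hcon
      exact hpq (plane_ext (by linarith [hcon.1]) (by linarith [hcon.2]))
    unfold orient at h
    rcases h' with h' | h'
    · refine ⟨(r 0 - p 0) / (q 0 - p 0), plane_ext ?_ ?_⟩ <;>
        simp only [vadd_eq_add, PiLp.add_apply, PiLp.smul_apply, PiLp.sub_apply, smul_eq_mul] <;>
        field_simp <;> linarith
    · refine ⟨(r 1 - p 1) / (q 1 - p 1), plane_ext ?_ ?_⟩ <;>
        simp only [vadd_eq_add, PiLp.add_apply, PiLp.smul_apply, PiLp.sub_apply, smul_eq_mul] <;>
        field_simp <;> linarith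
  intro x hx
  rcases hx with rfl | rfl | rfl
  · exact ⟨0, by simp⟩
  · exact ⟨1, by simp⟩
  · exact hr

theorem IsConvexPolygon.orient_ne_zero {V : Finset Plane} (hV : IsConvexPolygon V) {x y z : Plane}
    (hx : x ∈ V) (hy : y ∈ V) (hz : z ∈ V) (hxy : x ≠ y) (hxz : x ≠ z) (hyz : y ≠ z) :
    orient x y z ≠ 0 := by
  intro h
  rcases (collinear_of_orient_eq_zero hxy h).wbtw_or_wbtw_or_wbtw with h | h | h
  · exact hV.not_wbtw hx hy hz hxy hyz.symm h
  · exact hV.not_wbtw hy hz hx hyz hxz h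
  · exact hV.not_wbtw hz hx hy hxz.symm hxy.symm h

/-- Otherwise `v` would be a convex combination of `x`, `y` and `z`. Sorting the other vertices
counterclockwise around `v` is thus a linear order. -/
theorem IsConvexPolygon.orient_trans {V : Finset Plane} (hV : IsConvexPolygon V) {v x y z : Plane}
    (hv : v ∈ V) (hx : x ∈ V) (hy : y ∈ V) (hz : z ∈ V) (hxv : x ≠ v) (hyv : y ≠ v) (hzv : z ≠ v)
    (hxy : 0 < orient v x y) (hyz : 0 < orient v y z) : 0 < orient v x z := by
  have hxz : x ≠ z := by
    rintro rfl
    have : orient v y x = - orient v x y := by unfold orient; ring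
    linarith
  by_contra hcon
  refine hV.no_combo hv hx hy hz hxv hyv hzv (a := orient v y z) (b := - orient v x z)
    (c := orient v x y) hyz.le (by linarith) hxy.le (by linarith) ?_ ?_ <;>
  · unfold orient; ring

/-- Otherwise `y` would lie in the triangle `v x z`. This passes from the order around `v` to the
orientation of all triples. -/
theorem IsConvexPolygon.orient_pos_of_pos {V : Finset Plane} (hV : IsConvexPolygon V)
    {v x y z : Plane} (hv : v ∈ V) (hx : x ∈ V) (hy : y ∈ V) (hz : z ∈ V) (hyv : y ≠ v)
    (hxy : 0 < orient v x y) (hyz : 0 < orient v y z) (hxz : 0 < orient v x z) :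
    0 < orient x y z := by
  have hxy' : x ≠ y := by rintro rfl; unfold orient at hxy; linarith
  have hyz' : y ≠ z := by rintro rfl; unfold orient at hyz; linarith
  by_contra hcon
  have he : orient x y z = orient v x y + orient v y z - orient v x z := by unfold orient; ring
  refine hV.no_combo hy hx hz hv hxy' hyz'.symm hyv.symm (a := orient v y z) (b := orient v x y)
    (c := orient v x z - orient v y z - orient v x y) hyz.le hxy.le (by linarith) (by linarith)
    ?_ ?_ <;>
  · unfold orient; ring

/-! ### Cyclic labelling of the vertices -/

/-- The points `σ i`, for `i ∈ S`, are the vertices of the polygon in counterclockwise order. -/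
structure CyclicLabelling (V : Finset Plane) (S : Finset ℕ) (σ : ℕ → Plane) : Prop where
  mem : ∀ {i}, i ∈ S → σ i ∈ V
  inj : ∀ {i j}, i ∈ S → j ∈ S → σ i = σ j → i = j
  surj : ∀ {x}, x ∈ V → ∃ i ∈ S, σ i = x
  pos : ∀ {i j k}, i ∈ S → j ∈ S → k ∈ S → i < j → j < k → 0 < orient (σ i) (σ j) (σ k)

theorem IsConvexPolygon.exists_labelling {V : Finset Plane} (hV : IsConvexPolygon V) {v : Plane}
    (hv : v ∈ V) : ∃ S σ, CyclicLabelling V S σ ∧ 0 ∈ S ∧ σ 0 = v := by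
  classical
  -- The rank in the counterclockwise order around `v`, starting from 1, with 0 kept for `v`.
  let ρ : Plane → ℕ := fun x =>
    if x = v then 0 else 1 + (V.filter fun y => y ≠ v ∧ 0 < orient v y x).card
  have hρv : ρ v = 0 := by simp [ρ]
  have hρ : ∀ x, x ≠ v → ρ x = 1 + (V.filter fun y => y ≠ v ∧ 0 < orient v y x).card :=
    fun x hx => by simp [ρ, hx]
  have hlt : ∀ x ∈ V, ∀ y ∈ V, x ≠ v → y ≠ v → 0 < orient v x y → ρ x < ρ y := by
    intro x hx y hy hxv hyv hxy
    rw [hρ x hxv, hρ y hyv]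
    refine Nat.add_lt_add_left (Finset.card_lt_card ?_) 1
    rw [Finset.ssubset_iff_of_subset]
    · refine ⟨x, by simp [hx, hxv, hxy], fun h => ?_⟩
      have := (Finset.mem_filter.1 h).2.2
      rw [orient_self_right] at this
      exact lt_irrefl _ this
    · intro z hz
      obtain ⟨hz, hzv, hzx⟩ := Finset.mem_filter.1 hz
      exact Finset.mem_filter.2 ⟨hz, hzv, hV.orient_trans hv hz hx hy hzv hxv hyv hzx hxy⟩
  have htot : ∀ x ∈ V, ∀ y ∈ V, x ≠ v → y ≠ v → x ≠ y → 0 < orient v x y ∨ 0 < orient v y x := by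
    intro x hx y hy hxv hyv hxy
    have h1 := hV.orient_ne_zero hv hx hy hxv.symm hyv.symm hxy
    have h2 : orient v y x = - orient v x y := by unfold orient; ring
    rcases lt_or_gt_of_ne h1 with h | h
    · right; linarith
    · left; exact h
  have hinj : Set.InjOn ρ (V : Set Plane) := by
    intro x hx y hy hxy
    by_contra hne
    by_cases hxv : x = v
    · subst hxv
      rw [hρv, hρ y (Ne.symm hne)] at hxy
      omega
    by_cases hyv : y = v
    · subst hyv
      rw [hρv, hρ x hne] at hxy
      omega
    rcases htot x hx y hy hxv hyv hne with h | h
    · exact (hlt x hx y hy hxv hyv h).ne hxy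
    · exact (hlt y hy x hx hyv hxv h).ne' hxy
  have hpos : ∀ x ∈ V, ∀ y ∈ V, x ≠ v → y ≠ v → ρ x < ρ y → 0 < orient v x y := by
    intro x hx y hy hxv hyv hxy
    refine (htot x hx y hy hxv hyv (by rintro rfl; exact lt_irrefl _ hxy)).resolve_right fun h => ?_
    exact (hlt y hy x hx hyv hxv h).not_gt hxy
  have hleft : ∀ x ∈ V, Function.invFunOn ρ (V : Set Plane) (ρ x) = x :=
    fun x hx => hinj.leftInvOn_invFunOn hx
  refine ⟨V.image ρ, Function.invFunOn ρ (V : Set Plane), ⟨?_, ?_, ?_, ?_⟩, ?_, ?_⟩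
  · intro i hi
    obtain ⟨x, hx, rfl⟩ := Finset.mem_image.1 hi
    rwa [hleft x hx]
  · intro i j hi hj hij
    obtain ⟨x, hx, rfl⟩ := Finset.mem_image.1 hi
    obtain ⟨y, hy, rfl⟩ := Finset.mem_image.1 hj
    rw [hleft x hx, hleft y hy] at hij
    rw [hij]
  · intro x hx
    exact ⟨ρ x, Finset.mem_image_of_mem _ hx, hleft x hx⟩
  · intro i j k hi hj hk hij hjk
    obtain ⟨x, hx, rfl⟩ := Finset.mem_image.1 hi
    obtain ⟨y, hy, rfl⟩ := Finset.mem_image.1 hj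
    obtain ⟨z, hz, rfl⟩ := Finset.mem_image.1 hk
    rw [hleft x hx, hleft y hy, hleft z hz]
    have hyv : y ≠ v := by rintro rfl; omega
    have hzv : z ≠ v := by rintro rfl; omega
    have hyz := hpos y hy z hz hyv hzv hjk
    by_cases hxv : x = v
    · rwa [hxv]
    · exact hV.orient_pos_of_pos hv hx hy hz hyv (hpos x hx y hy hxv hyv hij) hyz
        (hpos x hx z hz hxv hzv (hij.trans hjk))
  · exact Finset.mem_image.2 ⟨v, hv, hρv⟩
  · rw [← hρv]
    exact hleft v hv

/-! ### Crossings and boundary edges in terms of labels -/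

theorem convexHull_edge (p q : Plane) :
    convexHull ℝ ((open scoped Classical in {p, q} : Finset Plane) : Set Plane) =
      segment ℝ p q := by
  classical
  rw [← convexHull_pair]
  simp

theorem openEdge_eq {p q : Plane} (hpq : p ≠ q) :
    openEdge (open scoped Classical in {p, q}) = openSegment ℝ p q := by
  classical
  unfold openEdge
  rw [convexHull_edge, ← insert_endpoints_openSegment]
  ext x
  simp only [Finset.coe_insert, Finset.coe_singleton, Set.mem_sdiff, Set.mem_insert_iff,
    Set.mem_singleton_iff]
  constructor
  · tauto
  · intro hx
    refine ⟨Or.inr (Or.inr hx), ?_⟩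
    rintro (rfl | rfl)
    · exact hpq (left_mem_openSegment_iff.1 hx)
    · exact hpq (right_mem_openSegment_iff.1 hx)

/-- The diagonals of a convex quadrilateral meet at a point in which each vertex is weighted by the
area of the triangle on the other three. -/
theorem exists_mem_openSegment_inter {A B C D : Plane} (hABC : 0 < orient A B C)
    (hACD : 0 < orient A C D) (hABD : 0 < orient A B D) (hBCD : 0 < orient B C D) :
    ∃ P, P ∈ openSegment ℝ A C ∧ P ∈ openSegment ℝ B D := by
  have hs : orient A C D + orient A B C = orient B C D + orient A B D := by unfold orient; ring
  have hpos : 0 < orient B C D + orient A B D := by linarith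
  have h0 : orient B C D * A 0 + orient A B D * C 0 = orient A C D * B 0 + orient A B C * D 0 := by
    unfold orient; ring
  have h1 : orient B C D * A 1 + orient A B D * C 1 = orient A C D * B 1 + orient A B C * D 1 := by
    unfold orient; ring
  generalize orient B C D = a at *
  generalize orient A B D = b at *
  generalize orient A C D = c at *
  generalize orient A B C = d at *
  refine ⟨(a / (a + b)) • A + (b / (a + b)) • C,
    ⟨a / (a + b), b / (a + b), by positivity, by positivity, by field_simp, rfl⟩,
    ⟨c / (a + b), d / (a + b), by positivity, by positivity, by rw [← add_div, hs, div_self hpos.ne'],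
    ?_⟩⟩
  apply plane_ext <;>
  simp only [PiLp.add_apply, PiLp.smul_apply, smul_eq_mul, div_mul_eq_mul_div, ← add_div, h0, h1]

theorem exists_mem_segment_interior {A B C D : Plane} (hABC : 0 < orient A B C)
    (hACD : 0 < orient A C D) (hABD : 0 < orient A B D) (hBCD : 0 < orient B C D) {K : Set Plane}
    (hA : A ∈ K) (hB : B ∈ K) (hD : D ∈ K) :
    ∃ M ∈ segment ℝ A C, M ∈ interior (convexHull ℝ K) := by
  obtain ⟨P, ⟨a, b, ha, hb, hab, rfl⟩, ⟨c, d, hc, hd, hcd, hP⟩⟩ :=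
    exists_mem_openSegment_inter hABC hACD hABD hBCD
  set P := a • A + b • C with hPdef
  -- Between `A` and the intersection `P` of the diagonals, the segment runs inside the triangle `A
  -- B D`; any point strictly between them would do.
  set M := (1 / 2 : ℝ) • A + (1 / 2 : ℝ) • P with hM
  have hhalf : (1 / 2 : ℝ) + 1 / 2 = 1 := by norm_num
  have hMseg : M ∈ segment ℝ A C := (convex_segment A C) (left_mem_segment ℝ A C)
    ⟨a, b, ha.le, hb.le, hab, rfl⟩ (by norm_num) (by norm_num) hhalf
  refine ⟨M, hMseg, mem_interior.2 ⟨{Q | 0 < orient A B Q} ∩ {Q | 0 < orient B D Q} ∩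
    {Q | 0 < orient D A Q}, ?_, ?_, ?_⟩⟩
  · rintro Q ⟨⟨h1, h2⟩, h3⟩
    simp only [Set.mem_ofPred_eq] at h1 h2 h3
    refine (convex_convexHull ℝ K).combo_three (subset_convexHull ℝ K hA)
      (subset_convexHull ℝ K hB) (subset_convexHull ℝ K hD) (a := orient B D Q)
      (b := orient D A Q) (c := orient A B Q) h2.le h3.le h1.le (by linarith) ?_ ?_ <;>
    · unfold orient; ring
  · exact ((isOpen_lt continuous_const (continuous_orient A B)).inter
      (isOpen_lt continuous_const (continuous_orient B D))).inter
      (isOpen_lt continuous_const (continuous_orient D A))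
  · have e1 : orient A B M = 1 / 2 * (b * orient A B C) := by
      rw [hM, orient_combo _ _ _ _ hhalf, hPdef, orient_combo _ _ _ _ hab, orient_self_left]
      ring
    have e2 : orient D A M = 1 / 2 * (b * orient A C D) := by
      rw [hM, orient_combo _ _ _ _ hhalf, hPdef, orient_combo _ _ _ _ hab, orient_self_right,
        orient_rotate C D A, orient_rotate A C D |>.symm]
      ring
    have e3 : orient B D M = 1 / 2 * orient A B D := by
      rw [hM, orient_combo _ _ _ _ hhalf, ← hP, orient_combo _ _ _ _ hcd, orient_self_left,
        orient_self_right, orient_rotate A B D]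
      ring
    refine ⟨⟨?_, ?_⟩, ?_⟩
    · show 0 < orient A B M
      rw [e1]; positivity
    · show 0 < orient B D M
      rw [e3]; positivity
    · show 0 < orient D A M
      rw [e2]; positivity

theorem Crossing.symm {e f : Finset Plane} (h : Crossing e f) : Crossing f e :=
  ⟨h.1.symm, by rw [Set.inter_comm]; exact h.2⟩

/-- The labels `i`, `j`, `k` are in cyclic order. -/
def CyclicOrder (i j k : ℕ) : Prop := (i < j ∧ j < k) ∨ (j < k ∧ k < i) ∨ (k < i ∧ i < j)

namespace CyclicLabelling

variable {V : Finset Plane} {S : Finset ℕ} {σ : ℕ → Plane}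

theorem card_eq (L : CyclicLabelling V S σ) : V.card = S.card := by
  classical
  have : V = S.image σ := by
    ext x
    rw [Finset.mem_image]
    exact ⟨fun hx => L.surj hx, by rintro ⟨i, hi, rfl⟩; exact L.mem hi⟩
  rw [this, Finset.card_image_of_injOn fun i hi j hj => L.inj hi hj]

theorem orient_pos (L : CyclicLabelling V S σ) {i j k : ℕ} (hi : i ∈ S) (hj : j ∈ S) (hk : k ∈ S)
    (h : CyclicOrder i j k) : 0 < orient (σ i) (σ j) (σ k) := by
  rcases h with ⟨h1, h2⟩ | ⟨h1, h2⟩ | ⟨h1, h2⟩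
  · exact L.pos hi hj hk h1 h2
  · rw [← orient_rotate]
    exact L.pos hj hk hi h1 h2
  · rw [← orient_rotate, ← orient_rotate]
    exact L.pos hk hi hj h1 h2

open scoped Classical in
theorem pair_eq_iff (L : CyclicLabelling V S σ) {i j k l : ℕ} (hi : i ∈ S) (hj : j ∈ S)
    (hk : k ∈ S) (hl : l ∈ S) :
    ({σ i, σ j} : Finset Plane) = {σ k, σ l} ↔ (i = k ∧ j = l) ∨ (i = l ∧ j = k) := by
  rw [← Finset.coe_inj, Finset.coe_pair, Finset.coe_pair, Set.pair_eq_pair_iff]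
  constructor
  · rintro (⟨h1, h2⟩ | ⟨h1, h2⟩)
    · exact Or.inl ⟨L.inj hi hk h1, L.inj hj hl h2⟩
    · exact Or.inr ⟨L.inj hi hl h1, L.inj hj hk h2⟩
  · rintro (⟨rfl, rfl⟩ | ⟨rfl, rfl⟩)
    · exact Or.inl ⟨rfl, rfl⟩
    · exact Or.inr ⟨rfl, rfl⟩

open scoped Classical in
theorem mem_edgesOn (L : CyclicLabelling V S σ) {e : Finset Plane} :
    e ∈ edgesOn V ↔ ∃ i ∈ S, ∃ j ∈ S, i ≠ j ∧ e = {σ i, σ j} := by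
  unfold edgesOn
  rw [Finset.mem_powersetCard, Finset.card_eq_two]
  constructor
  · rintro ⟨hV, x, y, hxy, rfl⟩
    obtain ⟨i, hi, rfl⟩ := L.surj (hV (Finset.mem_insert_self _ _))
    obtain ⟨j, hj, rfl⟩ := L.surj (hV (Finset.mem_insert_of_mem (Finset.mem_singleton_self _)))
    exact ⟨i, hi, j, hj, by rintro rfl; exact hxy rfl, rfl⟩
  · rintro ⟨i, hi, j, hj, hij, rfl⟩
    refine ⟨?_, σ i, σ j, fun h => hij (L.inj hi hj h), rfl⟩
    intro x hx
    rcases Finset.mem_insert.1 hx with rfl | hx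
    · exact L.mem hi
    · rw [Finset.mem_singleton.1 hx]
      exact L.mem hj

open scoped Classical in
theorem crossing_of_lt (L : CyclicLabelling V S σ) {i j k l : ℕ} (hi : i ∈ S) (hj : j ∈ S)
    (hk : k ∈ S) (hl : l ∈ S) (hij : i < j) (hjk : j < k) (hkl : k < l) :
    Crossing {σ i, σ k} {σ j, σ l} := by
  refine ⟨fun h => ?_, ?_⟩
  · rw [L.pair_eq_iff hi hk hj hl] at h
    omega
  · rw [openEdge_eq fun h => (hij.trans hjk).ne (L.inj hi hk h),
      openEdge_eq fun h => (hjk.trans hkl).ne (L.inj hj hl h)]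
    exact exists_mem_openSegment_inter (L.pos hi hj hk hij hjk) (L.pos hi hk hl (hij.trans hjk) hkl)
      (L.pos hi hj hl hij (hjk.trans hkl)) (L.pos hj hk hl hjk hkl)

-- The function `orient (σ i) (σ j)` is affine and vanishes at a common point of the open edges.
-- Hence `k` and `l` lie strictly on opposite sides, or both on the line, and then the edges
-- coincide. Conversely, interleaving edges are diagonals of a convex quadrilateral.
open scoped Classical in
theorem crossing_iff (L : CyclicLabelling V S σ) {i j k l : ℕ} (hi : i ∈ S) (hj : j ∈ S)
    (hk : k ∈ S) (hl : l ∈ S) (hij : i ≠ j) (hkl : k ≠ l) :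
    Crossing {σ i, σ j} {σ k, σ l} ↔ Interleave i j k l := by
  constructor
  · rintro ⟨hne, P, hP1, hP2⟩
    rw [ne_eq, L.pair_eq_iff hi hj hk hl] at hne
    rw [openEdge_eq fun h => hij (L.inj hi hj h)] at hP1
    rw [openEdge_eq fun h => hkl (L.inj hk hl h)] at hP2
    obtain ⟨a, b, ha, hb, hab, rfl⟩ := hP1
    obtain ⟨c, d, hc, hd, hcd, hP⟩ := hP2
    have h0 : c * orient (σ i) (σ j) (σ k) + d * orient (σ i) (σ j) (σ l) = 0 := by
      rw [← orient_combo _ _ _ _ hcd, hP, orient_combo _ _ _ _ hab, orient_self_left,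
        orient_self_right]
      ring
    have hcases : ∀ k ∈ S, (k = i ∧ orient (σ i) (σ j) (σ k) = 0) ∨
        (k = j ∧ orient (σ i) (σ j) (σ k) = 0) ∨
        (CyclicOrder i j k ∧ 0 < orient (σ i) (σ j) (σ k)) ∨
        (CyclicOrder j i k ∧ orient (σ i) (σ j) (σ k) < 0) := by
      intro k hk
      by_cases hki : k = i
      · exact Or.inl ⟨hki, by rw [hki, orient_self_left]⟩
      by_cases hkj : k = j
      · exact Or.inr (Or.inl ⟨hkj, by rw [hkj, orient_self_right]⟩)
      have : CyclicOrder i j k ∨ CyclicOrder j i k := by unfold CyclicOrder; omega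
      rcases this with h | h
      · exact Or.inr (Or.inr (Or.inl ⟨h, L.orient_pos hi hj hk h⟩))
      · refine Or.inr (Or.inr (Or.inr ⟨h, ?_⟩))
        have := L.orient_pos hj hi hk h
        rw [orient_swap] at this
        linarith
    have hsep : (CyclicOrder i j k ∧ CyclicOrder j i l) ∨ (CyclicOrder j i k ∧ CyclicOrder i j l) →
        Interleave i j k l := by
      unfold CyclicOrder Interleave
      grind
    rcases hcases k hk with ⟨h1, h2⟩ | ⟨h1, h2⟩ | ⟨h1, h2⟩ | ⟨h1, h2⟩ <;>
    rcases hcases l hl with ⟨h3, h4⟩ | ⟨h3, h4⟩ | ⟨h3, h4⟩ | ⟨h3, h4⟩ <;>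
    first
    | exact hsep (Or.inl ⟨h1, h3⟩)
    | exact hsep (Or.inr ⟨h1, h3⟩)
    | (exfalso; omega)
    | (exfalso; nlinarith [mul_pos hc h2, mul_pos hd h4])
    | (exfalso; rw [h2] at h0; nlinarith [mul_pos hd h4])
    | (exfalso; rw [h4] at h0; nlinarith [mul_pos hc h2])
    | (exfalso; nlinarith [mul_neg_of_pos_of_neg hc h2, mul_neg_of_pos_of_neg hd h4])
    | (exfalso; rw [h2] at h0; nlinarith [mul_neg_of_pos_of_neg hd h4])
    | (exfalso; rw [h4] at h0; nlinarith [mul_neg_of_pos_of_neg hc h2])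
  · intro h
    have key : ∀ {i j k l : ℕ}, i ∈ S → j ∈ S → k ∈ S → l ∈ S → i < k → k < j → (l < i ∨ j < l) →
        Crossing {σ i, σ j} {σ k, σ l} := by
      intro i j k l hi hj hk hl h1 h2 h3
      rcases h3 with h3 | h3
      · rw [Finset.pair_comm (σ k)]
        exact (L.crossing_of_lt hl hi hk hj h3 h1 h2).symm
      · exact L.crossing_of_lt hi hk hj hl h1 h2 h3
    rcases h with ⟨h1, h2, h3⟩ | ⟨h1, h2, h3⟩ | ⟨h1, h2, h3⟩ | ⟨h1, h2, h3⟩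
    · exact key hi hj hk hl h1 h2 h3
    · rw [Finset.pair_comm (σ i)]
      exact key hj hi hk hl h1 h2 h3
    · rw [Finset.pair_comm (σ k)]
      exact key hi hj hl hk h1 h2 h3
    · rw [Finset.pair_comm (σ i), Finset.pair_comm (σ k)]
      exact key hj hi hl hk h1 h2 h3

theorem disjoint_segment_interior {A B : Plane} (hAB : A ≠ B) {K : Set Plane}
    (hK : ∀ x ∈ K, 0 ≤ orient A B x) : Disjoint (segment ℝ A B) (interior (convexHull ℝ K)) := by
  rw [Set.disjoint_left]
  rintro x ⟨a, b, ha, hb, hab, rfl⟩ hx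
  have hconv : Convex ℝ {x | 0 ≤ orient A B x} := by
    intro x hx y hy a b ha hb hab
    simp only [Set.mem_ofPred_eq] at hx hy ⊢
    rw [orient_combo _ _ _ _ hab]
    positivity
  have hhull : convexHull ℝ K ⊆ {x | 0 ≤ orient A B x} := convexHull_min hK hconv
  have h0 : orient A B (a • A + b • B) = 0 := by
    rw [orient_combo _ _ _ _ hab, orient_self_left, orient_self_right]
    ring
  set x := a • A + b • B
  -- The direction from `A` to `B` turned clockwise, along which `orient A B` decreases.
  let w : Plane := !₂[B 1 - A 1, -(B 0 - A 0)]
  have hcont : Continuous fun t : ℝ => x + t • w := by fun_prop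
  have hnhds : ∀ᶠ t in nhds (0 : ℝ), x + t • w ∈ interior (convexHull ℝ K) :=
    (hcont.isOpen_preimage _ isOpen_interior).mem_nhds (by simpa using hx)
  obtain ⟨t, ht, ht0⟩ := ((hnhds.filter_mono nhdsWithin_le_nhds).and
    (self_mem_nhdsWithin (a := (0 : ℝ)) (s := Set.Ioi 0))).exists
  have ht0 : 0 < t := ht0
  have h1 : 0 ≤ orient A B (x + t • w) := hhull (interior_subset ht)
  have h2 : orient A B (x + t • w) =
      orient A B x - t * ((B 0 - A 0) ^ 2 + (B 1 - A 1) ^ 2) := by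
    simp [orient, w]
    ring
  have h3 : 0 < (B 0 - A 0) ^ 2 + (B 1 - A 1) ^ 2 := by
    by_contra! hcon
    refine hAB (plane_ext ?_ ?_) <;> nlinarith [sq_nonneg (B 0 - A 0), sq_nonneg (B 1 - A 1)]
  have := mul_pos ht0 h3
  linarith

-- Vertices on both sides make the edge a diagonal of a convex quadrilateral, which has an interior
-- point on it. Otherwise one side of its line contains the whole polygon.
open scoped Classical in
theorem isBoundaryEdge_iff (L : CyclicLabelling V S σ) {i j : ℕ} (hi : i ∈ S) (hj : j ∈ S)
    (hij : i ≠ j) :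
    IsBoundaryEdge V {σ i, σ j} ↔ ∀ r ∈ S, ∀ s ∈ S, ¬ Interleave i j r s := by
  have hne : ∀ {i j}, i ∈ S → j ∈ S → i ≠ j → σ i ≠ σ j := fun hi hj h h' => h (L.inj hi hj h')
  constructor
  · rintro ⟨-, hd⟩ r hr s hs hI
    rw [convexHull_edge, Set.disjoint_left] at hd
    have key : ∀ {i j r s}, i ∈ S → j ∈ S → r ∈ S → s ∈ S → CyclicOrder i r j →
        CyclicOrder i j s → ∃ M ∈ segment ℝ (σ i) (σ j), M ∈ interior (convexHull ℝ (V : Set Plane))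
        := by
      intro i j r s hi hj hr hs h1 h2
      refine exists_mem_segment_interior (L.orient_pos hi hr hj h1) (L.orient_pos hi hj hs h2)
        (L.orient_pos hi hr hs ?_) (L.orient_pos hr hj hs ?_) (L.mem hi) (L.mem hr) (L.mem hs)
      · unfold CyclicOrder at *; grind
      · unfold CyclicOrder at *; grind
    have : (CyclicOrder i r j ∧ CyclicOrder i j s) ∨ (CyclicOrder i s j ∧ CyclicOrder i j r) := by
      unfold CyclicOrder Interleave at *
      grind
    rcases this with h | h
    · obtain ⟨M, h1, h2⟩ := key hi hj hr hs h.1 h.2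
      exact hd h1 h2
    · obtain ⟨M, h1, h2⟩ := key hi hj hs hr h.1 h.2
      exact hd h1 h2
  · intro h
    refine ⟨L.mem_edgesOn.2 ⟨i, hi, j, hj, hij, rfl⟩, ?_⟩
    rw [convexHull_edge]
    have key : ∀ {i j}, i ∈ S → j ∈ S → i ≠ j → (∀ k ∈ S, ¬ CyclicOrder j i k) →
        Disjoint (segment ℝ (σ i) (σ j)) (interior (convexHull ℝ (V : Set Plane))) := by
      intro i j hi hj hij h
      refine disjoint_segment_interior (hne hi hj hij) fun x hx => ?_
      obtain ⟨k, hk, rfl⟩ := L.surj hx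
      by_cases hki : k = i
      · rw [hki, orient_self_left]
      by_cases hkj : k = j
      · rw [hkj, orient_self_right]
      refine (L.orient_pos hi hj hk ?_).le
      have := h k hk
      unfold CyclicOrder at *
      omega
    by_cases hside : ∀ k ∈ S, ¬ CyclicOrder j i k
    · exact key hi hj hij hside
    · push Not at hside
      obtain ⟨r, hr, hjr⟩ := hside
      rw [segment_symm]
      refine key hj hi hij.symm fun s hs hs' => h r hr s hs ?_
      unfold CyclicOrder Interleave at *
      grind

end CyclicLabelling

/-! ### From geometric triangulations to labels -/

open scoped Classical in
theorem IsTriangulation.mem_of_not_crossing {V : Finset Plane} {T : Finset (Finset Plane)}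
    (hT : IsTriangulation V T) {e : Finset Plane} (he : e ∈ edgesOn V)
    (h : ∀ f ∈ T, ¬ Crossing e f) : e ∈ T := by
  have hins : IsNoncrossing V (insert e T) := by
    refine ⟨Finset.insert_subset he hT.prop.1, ?_⟩
    intro f hf g hg hfg
    rcases Finset.mem_insert.1 hf with hf' | hf' <;> rcases Finset.mem_insert.1 hg with hg' | hg'
    · exact hfg.1 (hf'.trans hg'.symm)
    · exact h g hg' (hf' ▸ hfg)
    · exact h f hf' (hg' ▸ hfg.symm)
    · exact hT.prop.2 f hf' g hg' hfg
  exact hT.le_of_ge hins (Finset.subset_insert e T) (Finset.mem_insert_self e T)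

/-- The adjacency relation of `T` on the labels of the vertices. -/
def labelAdj (S : Finset ℕ) (σ : ℕ → Plane) (T : Finset (Finset Plane)) (i j : ℕ) : Prop :=
  i ∈ S ∧ j ∈ S ∧ i ≠ j ∧ (open scoped Classical in {σ i, σ j} : Finset Plane) ∈ T

theorem CyclicLabelling.combTri {V : Finset Plane} {S : Finset ℕ} {σ : ℕ → Plane}
    (L : CyclicLabelling V S σ) {T : Finset (Finset Plane)} (hT : IsTriangulation V T) :
    CombTri S (labelAdj S σ T) where
  symm := fun ⟨h1, h2, h3, h4⟩ => ⟨h2, h1, h3.symm, by rwa [Finset.pair_comm]⟩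
  left_mem := fun h => h.1
  ne := fun h => h.2.2.1
  noncross := by
    rintro p q r s ⟨h1, h2, h3, h4⟩ ⟨h5, h6, h7, h8⟩ hI
    exact hT.prop.2 _ h4 _ h8 ((L.crossing_iff h1 h2 h5 h6 h3 h7).2 hI)
  maximal := by
    intro p q hp hq hpq h
    refine ⟨hp, hq, hpq, hT.mem_of_not_crossing (L.mem_edgesOn.2 ⟨p, hp, q, hq, hpq, rfl⟩) ?_⟩
    intro f hf hc
    obtain ⟨r, hr, s, hs, hrs, rfl⟩ := L.mem_edgesOn.1 (hT.prop.1 hf)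
    exact h r s ⟨hr, hs, hrs, hf⟩ ((L.crossing_iff hp hq hr hs hpq hrs).1 hc)

open scoped Classical in
theorem CyclicLabelling.atMostOneLost {V : Finset Plane} {S : Finset ℕ} {σ : ℕ → Plane}
    (L : CyclicLabelling V S σ) {T U : Finset (Finset Plane)} (h : (T \ U).card = 1) :
    AtMostOneLost (labelAdj S σ T) (labelAdj S σ U) := by
  rintro p q r s ⟨h1, h2, h3, h4⟩ hU ⟨h5, h6, h7, h8⟩ hU'
  exact (L.pair_eq_iff h1 h2 h5 h6).1 (Finset.card_le_one.1 h.le _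
    (Finset.mem_sdiff.2 ⟨h4, fun h => hU ⟨h1, h2, h3, h⟩⟩) _
    (Finset.mem_sdiff.2 ⟨h8, fun h => hU' ⟨h5, h6, h7, h⟩⟩))

theorem CyclicLabelling.flipChain {V : Finset Plane} {S : Finset ℕ} {σ : ℕ → Plane}
    (L : CyclicLabelling V S σ) {T U : {T : Finset (Finset Plane) // IsTriangulation V T}}
    (w : (flipGraph V).Walk T U) :
    FlipChain S w.length (labelAdj S σ T.1) (labelAdj S σ U.1) := by
  induction w with
  | nil => exact .nil (L.combTri (Subtype.prop _))
  | cons h _ ih =>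
    exact .cons (L.combTri (Subtype.prop _)) (L.atMostOneLost h.1) (L.atMostOneLost h.2) ih

-- The two boundary edges at `w` cross nothing. With `w` labelled 0, they lead to the extreme
-- labels.
open scoped Classical in
theorem IsTriangulation.exists_two_neighbors {V : Finset Plane} (hV : IsConvexPolygon V)
    {T : Finset (Finset Plane)} (hT : IsTriangulation V T) {w : Plane} (hw : w ∈ V) :
    ∃ x y, x ≠ y ∧ x ≠ w ∧ y ≠ w ∧ ({w, x} : Finset Plane) ∈ T ∧ ({w, y} : Finset Plane) ∈ T := by
  obtain ⟨S, σ, L, h0, rfl⟩ := hV.exists_labelling hw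
  have hT' := L.combTri hT
  have hcard : 1 < (S.erase 0).card := by
    have := hV.1
    rw [Finset.card_erase_of_mem h0, ← L.card_eq]
    omega
  have hlt := Finset.min'_lt_max'_of_card _ hcard
  have hne : (S.erase 0).Nonempty := Finset.card_pos.1 (by omega)
  obtain ⟨m1, m2⟩ := Finset.mem_erase.1 ((S.erase 0).min'_mem hne)
  obtain ⟨n1, n2⟩ := Finset.mem_erase.1 ((S.erase 0).max'_mem hne)
  have hmin : ∀ z ∈ S, z ≠ 0 → (S.erase 0).min' hne ≤ z := fun z hz hz0 =>
    Finset.min'_le _ _ (Finset.mem_erase.2 ⟨hz0, hz⟩)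
  have hmax : ∀ z ∈ S, z ≠ 0 → z ≤ (S.erase 0).max' hne := fun z hz hz0 =>
    Finset.le_max' _ _ (Finset.mem_erase.2 ⟨hz0, hz⟩)
  have e1 : labelAdj S σ T 0 ((S.erase 0).min' hne) := by
    refine hT'.maximal h0 m2 m1.symm fun r s hrs => ?_
    have := hmin r (hT'.left_mem hrs)
    have := hmin s (hT'.right_mem hrs)
    unfold Interleave
    grind
  have e2 : labelAdj S σ T 0 ((S.erase 0).max' hne) := by
    refine hT'.maximal h0 n2 n1.symm fun r s hrs => ?_
    have := hmax r (hT'.left_mem hrs)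
    have := hmax s (hT'.right_mem hrs)
    unfold Interleave
    grind
  exact ⟨_, _, fun h => hlt.ne (L.inj m2 n2 h), fun h => m1 (L.inj m2 h0 h),
    fun h => n1 (L.inj n2 h0 h), e1.2.2.2, e2.2.2.2⟩

/-! ### Shellings, ears and degrees -/

open scoped Classical in
theorem IsTriangulation.subset_of_mem {V : Finset Plane} {T : Finset (Finset Plane)}
    (hT : IsTriangulation V T) {e : Finset Plane} (he : e ∈ T) : e ⊆ V :=
  (Finset.mem_powersetCard.1 (hT.prop.1 he)).1

open scoped Classical in
/-- The polygons of a shelling are spanned by the vertices that are not yet reached. -/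
theorem IsShelling.isTriangulation {V : Finset Plane} (hV : IsConvexPolygon V)
    {T : Finset (Finset Plane)} (hT : IsTriangulation V T) {v : Plane} {k : ℕ} {a : Fin k → Plane}
    (h : IsShelling V T v a) {i : ℕ} (hi : i ≤ k) :
    IsConvexPolygon (V.filter fun x => ∀ j : Fin k, i ≤ j → x ≠ a j) ∧
    IsTriangulation (V.filter fun x => ∀ j : Fin k, i ≤ j → x ≠ a j)
      (T.filter fun e => ∀ j : Fin k, i ≤ j → a j ∉ e) := by
  induction hi using Nat.decreasingInduction with
  | self =>
    have h1 : (V.filter fun x => ∀ j : Fin k, k ≤ j → x ≠ a j) = V :=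
      Finset.filter_true_of_mem fun x _ j hj => absurd j.2 (not_lt.2 hj)
    have h2 : (T.filter fun e => ∀ j : Fin k, k ≤ j → a j ∉ e) = T :=
      Finset.filter_true_of_mem fun x _ j hj => absurd j.2 (not_lt.2 hj)
    rw [h1, h2]
    exact ⟨hV, hT⟩
  | of_succ i hi ih =>
    obtain ⟨W, hW, hTW⟩ := h.2.2 ⟨i, hi⟩
    have hfilter : (T.filter fun e => ∀ j : Fin k, i ≤ j → a j ∉ e) =
        T.filter fun e => ∀ j : Fin k, (⟨i, hi⟩ : Fin k) ≤ j → a j ∉ e := rfl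
    rw [hfilter]
    -- The definition of a shelling does not say which polygon `W` is. It is identified by its
    -- edges: a remaining vertex has two neighbours one stage earlier, at most one of which is `a
    -- i`, so one of its edges survives.
    suffices hWV : (V.filter fun x => ∀ j : Fin k, i ≤ j → x ≠ a j) = W by
      rw [hWV]
      exact ⟨hW, hTW⟩
    ext x
    rw [Finset.mem_filter]
    constructor
    · rintro ⟨hx, hxa⟩
      obtain ⟨y, z, hyz, -, -, hy, hz⟩ := ih.2.exists_two_neighbors ih.1 (w := x)
        (Finset.mem_filter.2 ⟨hx, fun j hj => hxa j (by omega)⟩)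
      have key : ∀ y, ({x, y} : Finset Plane) ∈ T.filter (fun e => ∀ j : Fin k, i + 1 ≤ j → a j ∉ e)
          → y ≠ a ⟨i, hi⟩ → x ∈ W := by
        intro y hy hya
        obtain ⟨hyT, hy⟩ := Finset.mem_filter.1 hy
        refine hTW.subset_of_mem (e := {x, y}) (Finset.mem_filter.2 ⟨hyT, fun j hj => ?_⟩)
          (Finset.mem_insert_self _ _)
        rcases (show i ≤ j from hj).lt_or_eq with hj' | hj'
        · exact hy j hj'
        · obtain rfl : j = ⟨i, hi⟩ := Fin.ext hj'.symm
          intro hmem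
          rcases Finset.mem_insert.1 hmem with h | h
          · exact hxa _ le_rfl h.symm
          · exact hya (Finset.mem_singleton.1 h).symm
      by_cases hya : y = a ⟨i, hi⟩
      · exact key z hz fun h => hyz (hya.trans h.symm)
      · exact key y hy hya
    · intro hx
      obtain ⟨y, -, -, -, -, hy, -⟩ := hTW.exists_two_neighbors hW hx
      obtain ⟨hyT, hy⟩ := Finset.mem_filter.1 hy
      refine ⟨hT.subset_of_mem hyT (Finset.mem_insert_self _ _), fun j hj hxj => ?_⟩
      exact hy j hj (hxj ▸ Finset.mem_insert_self _ _)

-- Any edge at the ear other than the two boundary edges would cross the edge `{b, c}` that cuts it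
-- off.
open scoped Classical in
theorem HasEar.not_interleave {V : Finset Plane} {S : Finset ℕ} {σ : ℕ → Plane}
    (L : CyclicLabelling V S σ) {U : Finset (Finset Plane)} (hU : IsTriangulation V U) {v : ℕ}
    (hv : v ∈ S) (h : HasEar V U (σ v)) {x : ℕ} (hx : labelAdj S σ U v x) {r s : ℕ} (hr : r ∈ S)
    (hs : s ∈ S) : ¬ Interleave v x r s := by
  have hC := L.combTri hU
  obtain ⟨b, c, hbc, hvb, hvc, hbU, hcU, hbcU⟩ := h
  obtain ⟨b, hb, rfl⟩ := L.surj (hU.subset_of_mem hbcU (Finset.mem_insert_self _ _))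
  obtain ⟨c, hc, rfl⟩ := L.surj (hU.subset_of_mem hbcU
    (Finset.mem_insert_of_mem (Finset.mem_singleton_self _)))
  have hne : ∀ {y}, ({σ v, σ y} : Finset Plane) ∈ U → v ≠ y := by
    rintro y hy rfl
    have := (Finset.mem_powersetCard.1 (hU.prop.1 hy)).2
    simp at this
  rw [L.isBoundaryEdge_iff hv hb (hne hbU)] at hvb
  rw [L.isBoundaryEdge_iff hv hc (hne hcU)] at hvc
  have hbc' : labelAdj S σ U b c := ⟨hb, hc, fun h => hbc (by rw [h]), hbcU⟩
  by_cases hxb : x = b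
  · rw [hxb]
    exact hvb r hr s hs
  by_cases hxc : x = c
  · rw [hxc]
    exact hvc r hr s hs
  exfalso
  have h1 := hvb c hc x hx.2.1
  have h2 := hvc b hb x hx.2.1
  have h3 := hC.noncross hx hbc'
  have h4 := hne hbU
  have h5 := hne hcU
  have h6 := hx.2.2.1
  have h7 := hbc'.2.2.1
  clear hvb hvc hne
  unfold Interleave at h1 h2 h3
  grind (splits := 20)

open scoped Classical in
/-- At most two edges of the polygon meet at a vertex. -/
theorem card_boundary_le {V : Finset Plane} (hV : IsConvexPolygon V) {v : Plane} (hv : v ∈ V) :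
    (V.filter fun x => x ≠ v ∧ IsBoundaryEdge V {v, x}).card ≤ 2 := by
  obtain ⟨S, σ, L, h0, rfl⟩ := hV.exists_labelling hv
  have hcard : 1 < (S.erase 0).card := by
    have := hV.1
    rw [Finset.card_erase_of_mem h0, ← L.card_eq]
    omega
  have hne : (S.erase 0).Nonempty := Finset.card_pos.1 (by omega)
  have hsub : (V.filter fun x => x ≠ σ 0 ∧ IsBoundaryEdge V {σ 0, x}) ⊆
      {σ ((S.erase 0).min' hne), σ ((S.erase 0).max' hne)} := by
    intro x hx
    obtain ⟨hx, hxv, hxB⟩ := Finset.mem_filter.1 hx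
    obtain ⟨i, hi, rfl⟩ := L.surj hx
    have hi0 : i ≠ 0 := by rintro rfl; exact hxv rfl
    rw [L.isBoundaryEdge_iff h0 hi hi0.symm] at hxB
    obtain ⟨m1, m2⟩ := Finset.mem_erase.1 ((S.erase 0).min'_mem hne)
    obtain ⟨n1, n2⟩ := Finset.mem_erase.1 ((S.erase 0).max'_mem hne)
    have h1 := Finset.min'_le _ _ (Finset.mem_erase.2 ⟨hi0, hi⟩)
    have h2 := Finset.le_max' _ _ (Finset.mem_erase.2 ⟨hi0, hi⟩)
    have h3 := hxB _ m2 _ n2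
    have : i = (S.erase 0).min' hne ∨ i = (S.erase 0).max' hne := by
      unfold Interleave at h3
      omega
    rcases this with h | h
    · rw [h]; simp
    · rw [h]; simp
  exact (Finset.card_le_card hsub).trans Finset.card_le_two

open scoped Classical in
theorem card_le_interiorDegree {V : Finset Plane} (hV : IsConvexPolygon V)
    (T : Finset (Finset Plane)) {v : Plane} (hv : v ∈ V) :
    V.card - 3 ≤ interiorDegree V T v + (nonNeighbors V T v).card := by
  have hsub : V.erase v ⊆ (V.filter fun x => x ≠ v ∧ IsBoundaryEdge V {v, x}) ∪
      (V.filter fun x => x ≠ v ∧ ({v, x} : Finset Plane) ∈ interiorEdges V T) ∪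
      nonNeighbors V T v := by
    intro x hx
    obtain ⟨hxv, hx⟩ := Finset.mem_erase.1 hx
    simp only [Finset.mem_union, Finset.mem_filter, interiorEdges, nonNeighbors]
    tauto
  have hint : (V.filter fun x => x ≠ v ∧ ({v, x} : Finset Plane) ∈ interiorEdges V T).card ≤
      interiorDegree V T v := by
    unfold interiorDegree
    refine Finset.card_le_card_of_injOn (fun x => {v, x}) ?_ ?_
    · intro x hx
      have := (Finset.mem_filter.1 hx).2.2
      exact Finset.mem_filter.2 ⟨this, Finset.mem_insert_self _ _⟩
    · intro x hx y hy hxy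
      have hxv := (Finset.mem_filter.1 hx).2.1
      have : x ∈ ({v, y} : Finset Plane) := by
        rw [← show ({v, x} : Finset Plane) = {v, y} from hxy]
        simp
      simpa [hxv] using this
  have h1 := Finset.card_le_card hsub
  have h2 := card_boundary_le hV hv
  have h3 := Finset.card_union_le ((V.filter fun x => x ≠ v ∧ IsBoundaryEdge V {v, x}) ∪
      (V.filter fun x => x ≠ v ∧ ({v, x} : Finset Plane) ∈ interiorEdges V T)) (nonNeighbors V T v)
  have h4 := Finset.card_union_le (V.filter fun x => x ≠ v ∧ IsBoundaryEdge V {v, x})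
      (V.filter fun x => x ≠ v ∧ ({v, x} : Finset Plane) ∈ interiorEdges V T)
  rw [Finset.card_erase_of_mem hv] at h1
  omega

/-! ### The lower bound for the flip distance -/

theorem mainTheorem4 (V : Finset Plane) (hV : IsConvexPolygon V)
    (v : Plane) (hv : v ∈ V)
    (T : {T : Finset (Finset Plane) // IsTriangulation V T})
    (k : ℕ) (hk : k ≤ V.card - 3)
    (hdeg : interiorDegree V T.1 v = V.card - 3 - k)
    (U : {U : Finset (Finset Plane) // IsTriangulation V U})
    (hU : U.1 ∈ Omega V T.1 v) :
    ((V.card - 3 + k : ℕ) : ℕ∞) ≤ (flipGraph V).edist T U := by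
  classical
  obtain ⟨-, hear, k', a, hsh, hint⟩ := hU
  -- The shelling comes with its own length `k'`. Counting the vertices around `v` gives this
  -- inequality, which suffices because the bound increases with `k`.
  have hk' : k ≤ k' := by
    have h1 := card_le_interiorDegree hV T.1 hv
    have h2 : (nonNeighbors V T.1 v).card = k' := by
      have : nonNeighbors V T.1 v = Finset.univ.image a := by
        apply Finset.coe_injective
        rw [← hsh.2.1]
        simp
      rw [this, Finset.card_image_of_injective _ hsh.1, Finset.card_univ, Fintype.card_fin]
    omega
  -- The extended distance is an infimum over walks, so connectedness of the flip-graph plays no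
  -- role.
  refine le_iInf fun w => ?_
  suffices h : V.card - 3 + k' ≤ w.length by exact_mod_cast (by omega)
  obtain ⟨S, σ, L, h0, rfl⟩ := hV.exists_labelling hv
  have hnon : ∀ j, a j ∈ V ∧ a j ≠ σ 0 ∧ ({σ 0, a j} : Finset Plane) ∉ T.1 := by
    intro j
    have : a j ∈ nonNeighbors V T.1 (σ 0) := by
      rw [← Finset.mem_coe, ← hsh.2.1]
      exact Set.mem_range_self j
    simpa [nonNeighbors] using this
  choose b hbS hbσ using fun j => L.surj (hnon j).1
  let c : ℕ → ℕ := fun i => if h : i < k' then b ⟨i, h⟩ else 0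
  have hc : ∀ i (h : i < k'), c i = b ⟨i, h⟩ := fun i h => dif_pos h
  have hcσ : ∀ i (h : i < k'), σ (c i) = a ⟨i, h⟩ := fun i h => by rw [hc i h, hbσ]
  have hcS : ∀ i < k', c i ∈ S := fun i h => by rw [hc i h]; exact hbS _
  have havoid : ∀ {i x}, x ∈ S → (∀ j, i ≤ j → j < k' → x ≠ c j) →
      ∀ j : Fin k', i ≤ (j : ℕ) → σ x ≠ a j := by
    intro i x hx h j hj he
    rw [← hcσ j j.2] at he
    exact h j hj j.2 (L.inj hx (hcS j j.2) he)
  rw [L.card_eq]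
  refine FlipChain.lower_bound (v := 0) k' (L.flipChain w) c h0 (L.card_eq ▸ hV.1)
    (fun _ _ => Nat.zero_le _) ?_ ?_ ?_ ?_ ?_ ?_
  · intro i hi
    refine ⟨hcS i hi, fun h => ?_, fun h => ?_⟩
    · exact (hnon ⟨i, hi⟩).2.1 (by rw [← hcσ i hi, h])
    · exact (hnon ⟨i, hi⟩).2.2 (by rw [← hcσ i hi]; exact h.2.2.2)
  · intro i hi j hj hij
    have : a ⟨i, hi⟩ = a ⟨j, hj⟩ := by rw [← hcσ i hi, ← hcσ j hj, hij]
    exact congrArg Fin.val (hsh.1 this)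
  · intro x hx hx0
    by_cases hE : ({σ 0, σ x} : Finset Plane) ∈ T.1
    · exact Or.inl ⟨h0, hx, hx0.symm, hE⟩
    · right
      have : σ x ∈ Set.range a := by
        rw [hsh.2.1]
        simp only [nonNeighbors, Finset.coe_filter]
        exact ⟨L.mem hx, fun h => hx0 (L.inj hx h0 h), hE⟩
      obtain ⟨j, hj⟩ := this
      exact ⟨j, j.2, L.inj (hcS j j.2) hx (by rw [hcσ j j.2, hj])⟩
  · intro i hi p hp q hq hpq hne hcr
    -- A boundary edge of the remaining polygon crosses no edge of its triangulation, so it belongs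
    -- to it and hence to `T`.
    obtain ⟨-, hTi⟩ := hsh.isTriangulation hV T.2 hi.le
    have hpW := havoid hp fun j h1 h2 => (hne j h1 h2).1
    have hqW := havoid hq fun j h1 h2 => (hne j h1 h2).2
    refine ⟨hp, hq, hpq, Finset.filter_subset _ _ (hTi.mem_of_not_crossing ?_ ?_)⟩
    · refine Finset.mem_powersetCard.2 ⟨?_, Finset.card_pair fun h => hpq (L.inj hp hq h)⟩
      intro x hx
      rcases Finset.mem_insert.1 hx with rfl | hx
      · exact Finset.mem_filter.2 ⟨L.mem hp, hpW⟩
      · rw [Finset.mem_singleton.1 hx]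
        exact Finset.mem_filter.2 ⟨L.mem hq, hqW⟩
    · intro f hf hcross
      obtain ⟨hfT, hf⟩ := Finset.mem_filter.1 hf
      obtain ⟨r, hr, s, hs, hrs, rfl⟩ := L.mem_edgesOn.1 (T.2.prop.1 hfT)
      refine hcr r hr s hs (fun j h1 h2 => ?_) ((L.crossing_iff hp hq hr hs hpq hrs).1 hcross)
      have := hf ⟨j, h2⟩ h1
      rw [← hcσ j h2] at this
      simp only [Finset.mem_insert, Finset.mem_singleton, not_or] at this
      exact ⟨fun h => this.1 (by rw [h]), fun h => this.2 (by rw [h])⟩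
  · intro i hi
    have key : ∀ e ∈ (interiorEdges V U.1).filter
        (fun e => a ⟨i, hi⟩ ∈ e ∧ ∀ x ∈ e, x ≠ a ⟨i, hi⟩ → ∀ j, ⟨i, hi⟩ ≤ j → x ≠ a j),
        ∃ x, e = {a ⟨i, hi⟩, σ x} ∧ labelAdj S σ U.1 (c i) x ∧
          (∀ j, i ≤ j → j < k' → x ≠ c j) ∧ ∃ r ∈ S, ∃ s ∈ S, Interleave (c i) x r s := by
      intro e he
      obtain ⟨he1, he2, he3⟩ := Finset.mem_filter.1 he
      obtain ⟨heU, heB⟩ := Finset.mem_filter.1 he1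
      have hgo : ∀ p ∈ S, ∀ q ∈ S, p ≠ q → e = {σ p, σ q} → a ⟨i, hi⟩ = σ p →
          ∃ x, e = {a ⟨i, hi⟩, σ x} ∧ labelAdj S σ U.1 (c i) x ∧
          (∀ j, i ≤ j → j < k' → x ≠ c j) ∧ ∃ r ∈ S, ∃ s ∈ S, Interleave (c i) x r s := by
        intro p hp q hq hpq hepq hap
        have hcp : c i = p := L.inj (hcS i hi) hp (by rw [hcσ i hi, hap])
        refine ⟨q, by rw [hap, hepq], ?_, ?_, ?_⟩
        · rw [hcp]
          exact ⟨hp, hq, hpq, hepq ▸ heU⟩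
        · intro j h1 h2 hqj
          refine he3 (σ q) (by rw [hepq]; simp) (fun h => hpq (L.inj hp hq ?_)) ⟨j, h2⟩ h1 ?_
          · rw [h, hap]
          · rw [hqj, hcσ j h2]
        · by_contra! hcon
          rw [hcp] at hcon
          exact heB (hepq ▸ (L.isBoundaryEdge_iff hp hq hpq).2 hcon)
      obtain ⟨p, hp, q, hq, hpq, hepq⟩ := L.mem_edgesOn.1 (U.2.prop.1 heU)
      have hmem := he2
      rw [hepq, Finset.mem_insert, Finset.mem_singleton] at hmem
      rcases hmem with h | h
      · exact hgo p hp q hq hpq hepq h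
      · exact hgo q hq p hp hpq.symm (by rw [hepq, Finset.pair_comm]) h
    obtain ⟨e, he, f, hf, hef⟩ := Finset.one_lt_card.1 (hint ⟨i, hi⟩)
    obtain ⟨x, rfl, hx⟩ := key e he
    obtain ⟨y, rfl, hy⟩ := key f hf
    refine ⟨x, y, by rintro rfl; exact hef rfl, ?_⟩
    rintro z (rfl | rfl)
    · exact hx
    · exact hy
  · intro x hx r hr s hs
    exact HasEar.not_interleave L U.2 h0 hear hx hr hs
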